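/- **Conventions.** For a Hausdorff space $X$, let $\mathcal B(X)$ be the set of formal convex combinations $\sum t_ix_i$ of finitely many points of $X$ (terms with $t_i=0$ are dropped, terms with the same point are merged), let $\mathcal B_n(X)$ be the set of those with at most $n$ points ($\mathcal B_0(X)=\emptyset$), and give $\mathcal B(X)$ the final topology for the maps $\Delta^{n-1}\times X^n\to\mathcal B(X)$, $(t,x)\mapsto\sum t_ix_i$, $n\ge 1$; all subsets carry the subspace topology. For points $p_1,\dots,p_k\in X$, the set $\mathcal B_n(X,p_1,\dots,p_k)$ consists of all $\sum_{i\le n}t_ix_i+\sum_{j\le k}s_ja_j$ with $x_i\in X$, $a_j\in\{p_1,\dots,p_k\}$, $t_i,s_j\ge 0$, $\sum t_i+\sum s_j=1$. For distinct $p_1,p_2\in X$ with weights $w_1,w_2>0$ put $w(p_i)=w_i$ and $w(x)=1$ for all other $x$; for $\rho>0$ let $\mathcal B_\rho^{Q}(X)$, $Q=\{p_1,p_2\}$, be the set of configurations in $\mathcal B(X)$ for which the sum of $w(x)$ over the points $x$ that occur with nonzero coefficient is at most $\rho$. $\Sigma$ is the unreduced suspension, with $\Sigma\emptyset=S^0$.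 A point $p\in X$ is *nondegenerate* if $(X,\{p\})$ is an NDR pair (this holds for all points of CW complexes and of manifolds). **Proposition.** Let $X=A_1\sqcup A_2$ with $A_1,A_2$ connected nonempty Hausdorff spaces, let $w_1,w_2,\rho>0$ and $n=\lfloor\rho\rfloor$. Write $\mathcal B_\rho^{Q_{1,1}}(X)$ for $\mathcal B_\rho^{Q}(X)$ when $p_1\in A_1$, $p_2\in A_2$, and $\mathcal B_\rho^{Q_{2,0}}(X)$ when $p_1\ne p_2$ both lie in $A_1$. In (2) and (4) assume in addition that $p_1,p_2$ are nondegenerate and that $A_1$ is path-connected; for the $Q_{1,1}$ statements there, assume also that $A_2$ is path-connected. There the wedge $A_1\vee A_2$ is formed at any nondegenerate points of $A_1$ and $A_2$, and $A_1\vee S^1$ at any point of $A_1$. 1. If $n+w_1+w_2\le\rho$, then $\mathcal B_\rho^{Q_{1,1}}(X)$ and $\mathcal B_\rho^{Q_{2,0}}(X)$ are contractible, and each is homotopy equivalent to the corresponding space $\mathcal B_n(X,p_1,p_2)$, which is contractible. 2. If $n+w_1\le\rho$, $n+w_2\le\rho$ and $n+w_1+w_2>\rho$, then $$\mathcal B_\rho^{Q_{1,1}}(X)\simeq\Sigma\mathcal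 B_n(A_1\vee A_2),\qquad \mathcal B_\rho^{Q_{2,0}}(X)\simeq\Sigma\mathcal B_n\big((A_1\vee S^1)\sqcup A_2\big).$$ 3. If $n+w_1\le\rho$, $n+w_2>\rho$ and $n+w_1+w_2\le 1+\rho$, then $\mathcal B_\rho^{Q_{1,1}}(X)$ and $\mathcal B_\rho^{Q_{2,0}}(X)$ are contractible. 4. If $n+w_1>\rho$, $n+w_2>\rho$ and $n+w_1+w_2\le 1+\rho$, then $$\mathcal B_\rho^{Q_{1,1}}(X)\simeq\mathcal B_n(A_1\vee A_2),\qquad \mathcal B_\rho^{Q_{2,0}}(X)\simeq\mathcal B_n\big((A_1\vee S^1)\sqcup A_2\big).$$ 5. If $\rho<n+w_1\le 1+\rho$, $\rho<n+w_2\le 1+\rho$ and $1+\rho<n+w_1+w_2\le 2+\rho$, then $$\mathcal B_\rho^{Q_{1,1}}(X)=\mathcal B_n(X)=\mathcal B_\rho^{Q_{2,0}}(X).$$ (When $w_1,w_2\le 1$, the condition $n+w_1+w_2\le 1+\rho$ in (3) and the condition $n+w_1+w_2\le 2+\rho$ in (5) hold automatically.) -/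

import Mathlib

open scoped unitInterval ContinuousMap

universe u v

/-- The set underlying the space `𝓑(X)` of formal barycenters of `X`: formal convex combinations
`∑ tᵢ xᵢ` of finitely many points of `X`, where terms with `tᵢ = 0` are dropped and terms with
equal `xᵢ` are merged, i.e. finitely supported functions `X → [0, ∞)` of total mass `1`. -/
def Bary (X : Type u) : Type u := Convexity.StdSimplex ℝ X

namespace Bary

variable {X : Type u}

/-- The set of points that occur in a configuration with a nonzero coefficient. -/
def support (μ : Bary X) : Finset X := (Convexity.StdSimplex.weights μ).support

/-- The configuration `∑ tᵢ xᵢ` given by `t ∈ Δⁿ⁻¹` and `x ∈ Xⁿ`. -/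
noncomputable def formalSum (n : ℕ) (c : stdSimplex ℝ (Fin n) × (Fin n → X)) : Bary X where
  weights := ∑ i, Finsupp.single (c.2 i) (c.1 i)
  nonneg := Finset.sum_nonneg fun i _ => Finsupp.single_nonneg.2 (c.1.2.1 i)
  total := by
    rw [← Finsupp.sum_finsetSum_index (fun _ => rfl) (fun _ _ _ => rfl)]
    simp only [Finsupp.sum_single_index]
    exact c.1.2.2

/-- The topology of `𝓑(X) = colim 𝓑ₙ(X)`: the final topology for the maps
`Δⁿ⁻¹ × Xⁿ → 𝓑(X)`, `(t, x) ↦ ∑ tᵢ xᵢ`, that is, the direct limit topology for the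
quotient topologies on the `𝓑ₙ(X)`. -/
noncomputable instance [TopologicalSpace X] : TopologicalSpace (Bary X) :=
  ⨆ n : ℕ, TopologicalSpace.coinduced (formalSum n) inferInstance

end Bary

/-- `𝓑ₙ(X)`: configurations of at most `n` points; in particular `𝓑₀(X) = ∅`. -/
def baryFiltration (X : Type u) (n : ℕ) : Set (Bary X) := {μ | μ.support.card ≤ n}

/-- The conical subspace `𝓑ₙ(X, A₁, …, A_k)`: all configurations
`t₁x₁ + ⋯ + tₙxₙ + s₁a₁ + ⋯ + s_k a_k` with `xᵢ ∈ X`, `aⱼ ∈ A₁ ∪ ⋯ ∪ A_k`, with nonnegative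
coefficients of total sum `1`. -/
def conicalBary {X : Type u} (n : ℕ) {k : ℕ} (A : Fin k → Set X) : Set (Bary X) :=
  {μ | ∃ (t : stdSimplex ℝ (Fin (n + k))) (x : Fin n → X) (a : Fin k → X),
    (∀ j, a j ∈ ⋃ i, A i) ∧ μ = Bary.formalSum (n + k) (t, Fin.append x a)}

/-- The weight function on `X` for singular points `p₁, …, p_r` (pairwise distinct)
with weights `w₁, …, w_r`: it is `wᵢ` at `pᵢ` and `1` at all other points. -/
noncomputable def singularWeight {X : Type u} {r : ℕ} (p : Fin r → X) (w : Fin r → ℝ) : X → ℝ :=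
  Function.extend p w fun _ => 1

/-- The weighted barycenter space `𝓑_ρ^Q(X)`, `Q = {p₁, …, p_r}`: configurations in `𝓑(X)` for
which the sum of the weights of the points that occur in them is at most `ρ`. -/
def weightedBary {X : Type u} {r : ℕ} (p : Fin r → X) (w : Fin r → ℝ) (ρ : ℝ) : Set (Bary X) :=
  {μ | ∑ x ∈ μ.support, singularWeight p w x ≤ ρ}

/-- The unreduced suspension `ΣY`: the cylinder `Y × [0, 1]` and two extra points (the poles),
with `Y × {0}` glued to one pole and `Y × {1}` to the other. In particular `Σ∅` has two points. -/
inductive SuspensionRel (Y : Type u) : (Y × I) ⊕ Bool → (Y × I) ⊕ Bool → Prop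
  | south (y : Y) : SuspensionRel Y (Sum.inl (y, 0)) (Sum.inr false)
  | north (y : Y) : SuspensionRel Y (Sum.inl (y, 1)) (Sum.inr true)

/-- The unreduced suspension, with the quotient topology. -/
def Suspension (Y : Type u) : Type u := Quot (SuspensionRel Y)

instance (Y : Type u) [TopologicalSpace Y] : TopologicalSpace (Suspension Y) :=
  inferInstanceAs (TopologicalSpace (Quot (SuspensionRel Y)))

/-- The wedge `Y ∨ Z` of `(Y, y₀)` and `(Z, z₀)`: the disjoint union with `y₀` and `z₀`
identified. -/
def Wedge {Y : Type u} {Z : Type v} (y₀ : Y) (z₀ : Z) : Type (max u v) :=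
  Quot fun a b : Y ⊕ Z => a = Sum.inl y₀ ∧ b = Sum.inr z₀

instance {Y : Type u} {Z : Type v} [TopologicalSpace Y] [TopologicalSpace Z] (y₀ : Y) (z₀ : Z) :
    TopologicalSpace (Wedge y₀ z₀) :=
  inferInstanceAs (TopologicalSpace (Quot fun a b : Y ⊕ Z => a = Sum.inl y₀ ∧ b = Sum.inr z₀))

/-- `p` is a nondegenerate point of `X`: `(X, {p})` is an NDR pair (equivalently, `{p}` is closed
and its inclusion in `X` has the homotopy extension property). All points of CW complexes
and of manifolds are nondegenerate. -/
def IsNondegeneratePt {X : Type u} [TopologicalSpace X] (p : X) : Prop :=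
  ∃ (φ : C(X, I)) (h : C(X × I, X)),
    φ ⁻¹' {0} = {p} ∧ (∀ x, h (x, 0) = x) ∧ (∀ t, h (p, t) = p) ∧ ∀ x, φ x < 1 → h (x, 1) = p

/-!
Let `p` and `q` be the two singular points and `n = ⌊ρ⌋`. Counting weights
(`mem_weightedBary_iff`) shows that in the five regimes, in this order, the weighted space consists
of the configurations with

* at most `n` points besides `p` and `q`, which is the conical space;
* at most `n` points besides `p` or at most `n` points besides `q`: the union of two cones
  (`coneBary`);
* at most `n` points besides `p`: one cone;
* at most `n` points, if `p` and `q` are counted as one point (`mergedBary (merge p q) n`); this is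
  also the intersection of the two cones;
* at most `n` points.

The conical space and the cones are contracted to `p` along straight lines.

Let `E = Arc p q` be `X` with an arc attached from `p` to `q`. A point of the arc can be read as a
convex combination of `p` and `q`. Conversely, if `p` and `q` are nondegenerate, then neighborhoods
of them can be pulled into the arc so that `p` and `q` meet in its midpoint. The linear extensions
of these two maps show that the merged space is homotopy equivalent to `𝓑ₙ(E)`
(`NDRPair.mergedBary_homotopyEquiv`). As `𝓑ₙ` is a homotopy functor and the ends of the arc can be
moved along paths, `E` can be replaced by `A₁ ∨ A₂` or by `(A₁ ∨ S¹) ⊔ A₂`.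

The union of the two cones is homotopy equivalent to the suspension of their intersection
(`NDRPair.union_coneBary_homotopyEquiv`). In one direction, the suspension line of `ν` goes to the
broken line from `p` through `ν` to `q`. In the other one, a configuration is deformed so that
mass near `p` and `q` moves into `p` and `q`, then the excess of the mass at one of them over that
at the other one is taken away; the rest, rescaled, is the base coordinate, and the excess gives the
suspension coordinate. This uses the deformation around `p` and `q` only, although the
intersection of the cones need not be well embedded in them where points of a configuration collide.

All maps and homotopies are made from maps that are given on the whole of `𝓑(X)`, or on
`𝓑(X) × [0, 1]`, by explicit formulas, so that no quotient presentation of the subspaces is needed.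
Their continuity is checked on the `Δⁿ⁻¹ × Xⁿ`, using that locally they are finite sums of points
with continuous coefficients (`Bary.LocSumAt`); the notion is stable under linear extension.
-/

universe w

open Topology Filter Bary

/-! ### Configurations and linear extension -/

namespace Bary

variable {X : Type u} {Y : Type v}

/-- The coefficients of a configuration. -/
def weights (μ : Bary X) : X →₀ ℝ := Convexity.StdSimplex.weights μ

theorem weights_injective : Function.Injective (weights : Bary X → X →₀ ℝ) :=
  fun _ _ h => Convexity.StdSimplex.ext h

theorem weights_nonneg (μ : Bary X) (x : X) : 0 ≤ μ.weights x :=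
  Convexity.StdSimplex.nonneg μ x

theorem support_eq (μ : Bary X) : μ.support = μ.weights.support := rfl

theorem mem_support {μ : Bary X} {x : X} : x ∈ μ.support ↔ μ.weights x ≠ 0 :=
  Finsupp.mem_support_iff

/-- The sum of all coefficients of a finitely supported function. -/
noncomputable def mass : (Y →₀ ℝ) →ₗ[ℝ] ℝ := Finsupp.linearCombination ℝ fun _ => (1 : ℝ)

@[simp] theorem mass_single (y : Y) (a : ℝ) : mass (Finsupp.single y a) = a := by simp [mass]

theorem mass_eq_sum (F : Y →₀ ℝ) : mass F = F.sum fun _ a => a := by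
  simp [mass, Finsupp.linearCombination_apply]

@[simp] theorem mass_weights (μ : Bary X) : mass μ.weights = 1 := by
  rw [mass_eq_sum]; exact Convexity.StdSimplex.total μ

/-- A nonnegative finitely supported function of total mass `1`, as a configuration. -/
noncomputable def ofFinsupp (F : Y →₀ ℝ) (h0 : 0 ≤ F) (h1 : mass F = 1) : Bary Y :=
  ⟨F, h0, by rw [← mass_eq_sum]; exact h1⟩

/-- The configuration consisting of a single point. -/
noncomputable def dirac (x : X) : Bary X :=
  ofFinsupp (Finsupp.single x 1) (Finsupp.single_nonneg.2 zero_le_one) (mass_single x 1)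

@[simp] theorem weights_dirac (x : X) : (dirac x).weights = Finsupp.single x 1 := rfl

@[simp] theorem support_dirac (x : X) : (dirac x).support = {x} := by
  rw [support_eq, weights_dirac, Finsupp.support_single x one_ne_zero]

/-- The straight line from `μ` (at `t = 0`) to `ν` (at `t = 1`). -/
noncomputable def mix (t : I) (μ ν : Bary X) : Bary X :=
  ofFinsupp ((1 - t : ℝ) • μ.weights + (t : ℝ) • ν.weights)
    (add_nonneg (smul_nonneg (sub_nonneg.2 t.2.2) μ.weights_nonneg)
      (smul_nonneg t.2.1 ν.weights_nonneg))
    (by simp)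

@[simp] theorem weights_mix (t : I) (μ ν : Bary X) :
    (mix t μ ν).weights = (1 - t : ℝ) • μ.weights + (t : ℝ) • ν.weights := rfl

@[simp] theorem mix_zero (μ ν : Bary X) : mix 0 μ ν = μ := weights_injective (by simp)

@[simp] theorem mix_one (μ ν : Bary X) : mix 1 μ ν = ν := weights_injective (by simp)

@[simp] theorem mix_self (t : I) (μ : Bary X) : mix t μ μ = μ :=
  weights_injective (by simp [← add_smul])

theorem support_mix_subset [DecidableEq X] (t : I) (μ ν : Bary X) :
    (mix t μ ν).support ⊆ μ.support ∪ ν.support := by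
  rw [support_eq, weights_mix]
  exact Finsupp.support_add.trans
    (Finset.union_subset_union Finsupp.support_smul Finsupp.support_smul)

section Integ

variable {M : Type*} [AddCommGroup M] [Module ℝ M] {M' : Type*} [AddCommGroup M'] [Module ℝ M']

/-- The linear extension `∑ tᵢ K(xᵢ)` of a function `K` on `X`, at a configuration `∑ tᵢ xᵢ`. -/
noncomputable def integ (μ : Bary X) (K : X → M) : M := Finsupp.linearCombination ℝ K μ.weights

theorem integ_eq_sum (μ : Bary X) (K : X → M) :
    μ.integ K = ∑ x ∈ μ.support, μ.weights x • K x := by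
  rw [integ, Finsupp.linearCombination_apply]; rfl

theorem weights_formalSum (n : ℕ) (c : stdSimplex ℝ (Fin n) × (Fin n → X)) :
    (formalSum n c).weights = ∑ i, Finsupp.single (c.2 i) (c.1 i) := rfl

theorem integ_formalSum (n : ℕ) (c : stdSimplex ℝ (Fin n) × (Fin n → X)) (K : X → M) :
    (formalSum n c).integ K = ∑ i, (c.1 i) • K (c.2 i) := by
  simp [integ, weights_formalSum, map_sum]

theorem map_integ (l : M →ₗ[ℝ] M') (μ : Bary X) (K : X → M) :
    l (μ.integ K) = μ.integ fun x => l (K x) := by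
  simp [integ_eq_sum, map_sum]

theorem integ_add (μ : Bary X) (K K' : X → M) :
    (μ.integ fun x => K x + K' x) = μ.integ K + μ.integ K' := by
  simp [integ_eq_sum, Finset.sum_add_distrib]

theorem integ_sub (μ : Bary X) (K K' : X → M) :
    (μ.integ fun x => K x - K' x) = μ.integ K - μ.integ K' := by
  simp [integ_eq_sum, smul_sub]

theorem integ_const_smul (μ : Bary X) (a : ℝ) (K : X → M) :
    (μ.integ fun x => a • K x) = a • μ.integ K := by
  simp [integ_eq_sum, Finset.smul_sum, smul_comm a]

theorem integ_const (μ : Bary X) (m : M) : (μ.integ fun _ => m) = m := by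
  rw [integ_eq_sum, ← Finset.sum_smul]
  have : ∑ x ∈ μ.support, μ.weights x = 1 := by
    have := mass_weights μ
    rwa [mass_eq_sum] at this
  rw [this, one_smul]

theorem integ_dirac (x : X) (K : X → M) : (dirac x).integ K = K x := by
  simp [integ]

theorem integ_nonneg {μ : Bary X} {K : X → ℝ} (h : ∀ x, 0 ≤ K x) : 0 ≤ μ.integ K := by
  rw [integ_eq_sum]
  exact Finset.sum_nonneg fun x _ => mul_nonneg (μ.weights_nonneg x) (h x)

theorem integ_finsupp_nonneg {μ : Bary X} {K : X → Y →₀ ℝ} (h : ∀ x, 0 ≤ K x) :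
    0 ≤ μ.integ K := by
  rw [integ_eq_sum]
  exact Finset.sum_nonneg fun x _ => smul_nonneg (μ.weights_nonneg x) (h x)

theorem exists_pos_of_integ_pos {μ : Bary X} {K : X → ℝ} (h : 0 < μ.integ K) :
    ∃ x ∈ μ.support, 0 < K x := by
  by_contra! hc
  rw [integ_eq_sum] at h
  exact absurd h (not_lt.2 (Finset.sum_nonpos fun x hx =>
    mul_nonpos_of_nonneg_of_nonpos (μ.weights_nonneg x) (hc x hx)))

/-- A point with nonzero coefficient in `∑ tᵢ K(xᵢ)` has nonzero coefficient in some `K(xᵢ)`. -/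
theorem exists_of_mem_support_integ {μ : Bary X} {K : X → Y →₀ ℝ} {y : Y}
    (h : μ.integ K y ≠ 0) : ∃ x ∈ μ.support, K x y ≠ 0 := by
  by_contra! hc
  apply h
  rw [integ_eq_sum, Finsupp.finsetSum_apply]
  exact Finset.sum_eq_zero fun x hx => by simp [hc x hx]

end Integ

/-- The linear extension of a map `K : X → 𝓑(Y)` to `𝓑(X)`. -/
noncomputable def bind (μ : Bary X) (K : X → Bary Y) : Bary Y :=
  ofFinsupp (μ.integ fun x => (K x).weights)
    (integ_finsupp_nonneg fun x => (K x).weights_nonneg)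
    (by rw [map_integ]; simp [integ_const])

@[simp] theorem weights_bind (μ : Bary X) (K : X → Bary Y) :
    (μ.bind K).weights = μ.integ fun x => (K x).weights := rfl

theorem exists_of_mem_support_bind {μ : Bary X} {K : X → Bary Y} {y : Y}
    (h : y ∈ (μ.bind K).support) : ∃ x ∈ μ.support, y ∈ (K x).support := by
  obtain ⟨x, hx, h'⟩ := exists_of_mem_support_integ (mem_support.1 h)
  exact ⟨x, hx, mem_support.2 h'⟩

theorem mem_support_bind {μ : Bary X} {K : X → Bary Y} {x : X} {y : Y} (hx : x ∈ μ.support)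
    (hy : y ∈ (K x).support) : y ∈ (μ.bind K).support := by
  rw [mem_support, weights_bind, integ_eq_sum, Finsupp.finsetSum_apply]
  refine (Finset.sum_pos' (fun z _ => ?_) ⟨x, hx, ?_⟩).ne'
  · exact mul_nonneg (μ.weights_nonneg z) ((K z).weights_nonneg y)
  · exact mul_pos ((μ.weights_nonneg x).lt_of_ne' (mem_support.1 hx))
      (((K x).weights_nonneg y).lt_of_ne' (mem_support.1 hy))

theorem dirac_bind (x : X) (K : X → Bary Y) : (dirac x).bind K = K x :=
  weights_injective (by rw [weights_bind, integ_dirac])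

theorem bind_dirac (μ : Bary X) : μ.bind dirac = μ := by
  refine weights_injective ?_
  ext x
  simp [integ, Finsupp.linearCombination_apply]

theorem bind_bind {V : Type w} (μ : Bary X) (K : X → Bary Y) (K' : Y → Bary V) :
    (μ.bind K).bind K' = μ.bind fun x => (K x).bind K' := by
  refine weights_injective ?_
  have := map_integ (Finsupp.linearCombination ℝ fun y => (K' y).weights) μ
    fun x => (K x).weights
  exact this

theorem mix_bind (t : I) (μ ν : Bary X) (K : X → Bary Y) :
    (mix t μ ν).bind K = mix t (μ.bind K) (ν.bind K) := by
  refine weights_injective ?_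
  simp [integ]

theorem bind_mix_const (t : I) (μ ν : Bary X) :
    (μ.bind fun x => mix t (dirac x) ν) = mix t μ ν := by
  refine weights_injective ?_
  have h := congrArg weights (bind_dirac μ)
  rw [weights_bind] at h
  simp only [weights_bind, weights_mix, integ_add, integ_const]
  rw [integ_const_smul, h]

theorem support_formalSum_subset {n : ℕ} (c : stdSimplex ℝ (Fin n) × (Fin n → X)) {x : X}
    (hx : x ∈ (formalSum n c).support) : ∃ i, c.2 i = x := by
  by_contra! hc
  refine mem_support.1 hx ?_
  rw [weights_formalSum, Finsupp.finsetSum_apply]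
  exact Finset.sum_eq_zero fun i _ => Finsupp.single_eq_of_ne' (hc i)

/-- Every family of points that contains the points of `μ` can be used to write `μ` as a formal
sum. -/
theorem exists_formalSum_eq {n : ℕ} (μ : Bary X) (y : Fin n → X)
    (hy : ∀ x ∈ μ.support, ∃ i, y i = x) :
    ∃ t : stdSimplex ℝ (Fin n), formalSum n (t, y) = μ := by
  classical
  have hsum : ∑ x ∈ μ.support, μ.weights x = 1 := by
    have := mass_weights μ
    rwa [mass_eq_sum] at this
  obtain ⟨x₀, hx₀⟩ : μ.support.Nonempty :=
    Finset.nonempty_of_sum_ne_zero (hsum.trans_ne one_ne_zero)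
  have : Nonempty (Fin n) := ⟨(hy x₀ hx₀).choose⟩
  choose! s hs using hy
  refine ⟨⟨fun i => ∑ x ∈ μ.support, if s x = i then μ.weights x else 0, fun i => ?_, ?_⟩, ?_⟩
  · exact Finset.sum_nonneg fun x _ => by split_ifs; exacts [μ.weights_nonneg x, le_rfl]
  · rw [Finset.sum_comm]; simpa using hsum
  · refine weights_injective ?_
    have h1 : μ.weights = ∑ x ∈ μ.support, Finsupp.single x (μ.weights x) :=
      (Finsupp.sum_single μ.weights).symm
    rw [weights_formalSum]
    change ∑ i, Finsupp.single (y i) (∑ x ∈ μ.support, if s x = i then μ.weights x else 0) = _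
    refine Eq.trans ?_ h1.symm
    simp_rw [Finsupp.single_finsetSum]
    rw [Finset.sum_comm]
    refine Finset.sum_congr rfl fun x hx => ?_
    rw [Finset.sum_eq_single (s x)]
    · simp [hs x hx]
    · intro i _ hi; simp [hi.symm]
    · simp

end Bary

/-! ### Continuity of maps between spaces of configurations -/

/-- Continuity on an open set can be tested on a quotient presentation. -/
theorem Topology.IsQuotientMap.continuousOn_of_comp {A B Z : Type*} [TopologicalSpace A]
    [TopologicalSpace B] [TopologicalSpace Z] {f : A → B} (hf : IsQuotientMap f) {g : B → Z}
    {O : Set B} (hO : IsOpen O) (h : ∀ a, f a ∈ O → ContinuousAt (g ∘ f) a) :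
    ContinuousOn g O := by
  rw [continuousOn_open_iff hO]
  intro V hV
  rw [← hf.isOpen_preimage]
  exact (continuousOn_open_iff (hO.preimage hf.continuous)).1
    (fun a ha => (h a ha).continuousWithinAt) V hV

namespace Bary

section LocSum

variable {T : Type*} [TopologicalSpace T] {Y : Type v} [TopologicalSpace Y]

/-- A family `F` of finitely supported functions on `Y`, parametrized by a space `T`, is a
*continuous local sum* at `t₀` if near `t₀` it has the form `∑ⱼ cⱼ(t) gⱼ(t)` with finitely many
coefficients `cⱼ ≥ 0` and points `gⱼ` of `Y` that are continuous at `t₀`. -/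
def LocSumAt (F : T → Y →₀ ℝ) (t₀ : T) : Prop :=
  ∃ (ι : Type) (_ : Fintype ι) (c : ι → T → ℝ) (g : ι → T → Y),
    (∀ j, ContinuousAt (c j) t₀) ∧ (∀ j, ContinuousAt (g j) t₀) ∧
    ∀ᶠ t in 𝓝 t₀, (∀ j, 0 ≤ c j t) ∧ F t = ∑ j, Finsupp.single (g j t) (c j t)

namespace LocSumAt

variable {F G : T → Y →₀ ℝ} {t₀ : T}

theorem congr (hF : LocSumAt F t₀) (h : ∀ᶠ t in 𝓝 t₀, G t = F t) : LocSumAt G t₀ := by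
  obtain ⟨ι, i, c, g, hc, hg, H⟩ := hF
  refine ⟨ι, i, c, g, hc, hg, ?_⟩
  filter_upwards [H, h] with t h1 h2
  exact ⟨h1.1, h2.trans h1.2⟩

theorem single {c : T → ℝ} {g : T → Y} (hc : ContinuousAt c t₀) (hg : ContinuousAt g t₀)
    (h0 : ∀ t, 0 ≤ c t) : LocSumAt (fun t => Finsupp.single (g t) (c t)) t₀ :=
  ⟨Unit, inferInstance, fun _ => c, fun _ => g, fun _ => hc, fun _ => hg,
    .of_forall fun t => ⟨fun _ => h0 t, by simp⟩⟩

theorem dirac {g : T → Y} (hg : ContinuousAt g t₀) :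
    LocSumAt (fun t => (Bary.dirac (g t)).weights) t₀ :=
  single continuousAt_const hg fun _ => zero_le_one

theorem add (hF : LocSumAt F t₀) (hG : LocSumAt G t₀) : LocSumAt (fun t => F t + G t) t₀ := by
  obtain ⟨ι, i, c, g, hc, hg, H⟩ := hF
  obtain ⟨ι', i', c', g', hc', hg', H'⟩ := hG
  refine ⟨ι ⊕ ι', inferInstance, Sum.elim c c', Sum.elim g g', ?_, ?_, ?_⟩
  · rintro (j | j); exacts [hc j, hc' j]
  · rintro (j | j); exacts [hg j, hg' j]
  · filter_upwards [H, H'] with t h h'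
    refine ⟨?_, ?_⟩
    · rintro (j | j); exacts [h.1 j, h'.1 j]
    · simp [h.2, h'.2]

theorem smul {a : T → ℝ} (ha : ContinuousAt a t₀) (h0 : ∀ t, 0 ≤ a t) (hF : LocSumAt F t₀) :
    LocSumAt (fun t => a t • F t) t₀ := by
  obtain ⟨ι, i, c, g, hc, hg, H⟩ := hF
  refine ⟨ι, i, fun j t => a t * c j t, g, fun j => ha.mul (hc j), hg, ?_⟩
  filter_upwards [H] with t h
  refine ⟨fun j => mul_nonneg (h0 t) (h.1 j), ?_⟩
  simp [h.2, Finset.smul_sum]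

theorem sum {κ : Type} [Fintype κ] {F : κ → T → Y →₀ ℝ} (h : ∀ k, LocSumAt (F k) t₀) :
    LocSumAt (fun t => ∑ k, F k t) t₀ := by
  choose ι i c g hc hg H using h
  refine ⟨Σ k, ι k, inferInstance, fun j => c j.1 j.2, fun j => g j.1 j.2, fun j => hc _ _,
    fun j => hg _ _, ?_⟩
  filter_upwards [eventually_all.2 H] with t h
  refine ⟨fun j => (h j.1).1 j.2, ?_⟩
  rw [Fintype.sum_sigma]
  exact Finset.sum_congr rfl fun k _ => (h k).2

theorem comp {T' : Type*} [TopologicalSpace T'] {f : T' → T} {s : T'} (hF : LocSumAt F (f s))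
    (hf : ContinuousAt f s) : LocSumAt (fun t => F (f t)) s := by
  obtain ⟨ι, i, c, g, hc, hg, H⟩ := hF
  exact ⟨ι, i, fun j => c j ∘ f, fun j => g j ∘ f, fun j => (hc j).comp hf,
    fun j => (hg j).comp hf, hf.eventually H⟩

theorem mix {a : T → I} {f g : T → Bary Y} (ha : ContinuousAt a t₀)
    (hf : LocSumAt (fun t => (f t).weights) t₀) (hg : LocSumAt (fun t => (g t).weights) t₀) :
    LocSumAt (fun t => (Bary.mix (a t) (f t) (g t)).weights) t₀ := by
  have ha' : ContinuousAt (fun t => (a t : ℝ)) t₀ := continuous_subtype_val.continuousAt.comp ha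
  exact (hf.smul (continuousAt_const.sub ha') fun t => sub_nonneg.2 (a t).2.2).add
    (hg.smul ha' fun t => (a t).2.1)

end LocSumAt

theorem continuous_formalSum (n : ℕ) :
    Continuous (formalSum n : stdSimplex ℝ (Fin n) × (Fin n → Y) → Bary Y) :=
  continuous_iff_coinduced_le.2 (le_iSup (fun n : ℕ => TopologicalSpace.coinduced
    (formalSum n : stdSimplex ℝ (Fin n) × (Fin n → Y) → Bary Y) inferInstance) n)

/-- The maps `Δⁿ⁻¹ × Yⁿ → 𝓑(Y)` are continuous, and a continuous local sum factors near the
point in question through one of them. -/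
theorem continuousAt_of_locSumAt {f : T → Bary Y} {t₀ : T}
    (h : LocSumAt (fun t => (f t).weights) t₀) : ContinuousAt f t₀ := by
  classical
  obtain ⟨ι, i, c, g, hc, hg, H⟩ := h
  let e := Fintype.equivFin ι
  have hmem : ∀ t, ((∀ j, 0 ≤ c j t) ∧ (f t).weights = ∑ j, Finsupp.single (g j t) (c j t)) →
      (fun k => c (e.symm k) t) ∈ stdSimplex ℝ (Fin (Fintype.card ι)) := by
    rintro t ⟨h0, h1⟩
    refine ⟨fun k => h0 _, ?_⟩
    have h2 := mass_weights (f t)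
    rw [h1, map_sum] at h2
    simp only [mass_single] at h2
    rw [← h2]
    exact e.symm.sum_comp fun j => c j t
  let C : T → stdSimplex ℝ (Fin (Fintype.card ι)) := fun t =>
    if ht : (fun k => c (e.symm k) t) ∈ stdSimplex ℝ (Fin (Fintype.card ι)) then ⟨_, ht⟩
    else ⟨_, hmem t₀ H.self_of_nhds⟩
  have hC : ContinuousAt C t₀ := by
    rw [IsInducing.subtypeVal.continuousAt_iff]
    have : ContinuousAt (fun t => fun k => c (e.symm k) t) t₀ := continuousAt_pi.2 fun k => hc _
    refine this.congr ?_
    filter_upwards [H] with t ht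
    simp [C, hmem t ht]
  have hg' : ContinuousAt (fun t => fun k => g (e.symm k) t) t₀ := continuousAt_pi.2 fun k => hg _
  refine ((continuous_formalSum _).continuousAt.comp (hC.prodMk hg')).congr ?_
  filter_upwards [H] with t ht
  refine weights_injective ?_
  rw [ht.2, Function.comp_apply, weights_formalSum]
  simp only [C, hmem t ht, dif_pos]
  exact e.symm.sum_comp fun j => Finsupp.single (g j t) (c j t)

end LocSum

section Continuity

variable {X : Type u} {Y : Type v} [TopologicalSpace X] [TopologicalSpace Y]
  {T : Type*} [TopologicalSpace T]

/-- `𝓑(X)` carries the quotient topology from the disjoint union of the `Δⁿ⁻¹ × Xⁿ`. -/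
theorem isQuotientMap_formalSum :
    IsQuotientMap fun c : Σ n : ℕ, stdSimplex ℝ (Fin n) × (Fin n → X) => formalSum c.1 c.2 := by
  refine ⟨⟨?_⟩, fun μ => ?_⟩
  rotate_left
  · obtain ⟨t, ht⟩ := exists_formalSum_eq μ (fun i => (μ.support.equivFin.symm i : X))
      fun x hx => ⟨μ.support.equivFin ⟨x, hx⟩, by simp⟩
    exact ⟨⟨_, t, _⟩, ht⟩
  · rw [instTopologicalSpaceSigma, coinduced_iSup]
    rfl

theorem continuous_of_formalSum {Z : Type*} [TopologicalSpace Z] [LocallyCompactSpace T]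
    {G : Bary X × T → Z}
    (h : ∀ n, Continuous fun q : (stdSimplex ℝ (Fin n) × (Fin n → X)) × T =>
      G (formalSum n q.1, q.2)) : Continuous G := by
  refine isQuotientMap_formalSum.continuous_lift_prod_left ?_
  have : Continuous ((fun p : (Σ n : ℕ, stdSimplex ℝ (Fin n) × (Fin n → X)) × T =>
      G (formalSum p.1.1 p.1.2, p.2)) ∘ Homeomorph.sigmaProdDistrib.symm) :=
    continuous_sigma fun n => h n
  simpa [Function.comp_assoc] using this.comp Homeomorph.sigmaProdDistrib.continuous

/-- The linear extension of a continuous function is continuous. -/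
theorem continuous_integ {c : X → ℝ} (hc : Continuous c) :
    Continuous fun μ : Bary X => μ.integ c := by
  rw [isQuotientMap_formalSum.continuous_iff]
  refine continuous_sigma fun n => ?_
  change Continuous fun q : stdSimplex ℝ (Fin n) × (Fin n → X) => (formalSum n q).integ c
  simp_rw [integ_formalSum]
  refine continuous_finsetSum _ fun i _ => ?_
  exact ((continuous_apply i).comp (continuous_subtype_val.comp continuous_fst)).smul
    (hc.comp ((continuous_apply i).comp continuous_snd))

theorem LocSumAt.formalSum (n : ℕ) (q : stdSimplex ℝ (Fin n) × (Fin n → X)) :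
    LocSumAt (fun q : stdSimplex ℝ (Fin n) × (Fin n → X) => (formalSum n q).weights) q :=
  LocSumAt.sum fun i => LocSumAt.single
    ((continuous_apply i).comp (continuous_subtype_val.comp continuous_fst)).continuousAt
    ((continuous_apply i).comp continuous_snd).continuousAt fun q => q.1.2.1 i

theorem LocSumAt.integ {S : Type*} [TopologicalSpace S] {f : S → Bary X} {s₀ : S} {g : S → T}
    (hf : LocSumAt (fun s => (f s).weights) s₀) (hg : ContinuousAt g s₀) {K : X → T → Y →₀ ℝ}
    (hK : ∀ x t, LocSumAt (fun q : X × T => K q.1 q.2) (x, t)) :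
    LocSumAt (fun s => (f s).integ fun x => K x (g s)) s₀ := by
  obtain ⟨ι, i, c, a, hc, ha, H⟩ := hf
  -- Negative values of the coefficients away from `s₀` are irrelevant.
  have h : LocSumAt (fun s => ∑ j, max (c j s) 0 • K (a j s) (g s)) s₀ :=
    LocSumAt.sum fun j => LocSumAt.smul ((hc j).max continuousAt_const) (fun s => le_max_right _ _)
      (LocSumAt.comp (F := fun q : X × T => K q.1 q.2) (f := fun s => (a j s, g s)) (hK _ _)
        ((ha j).prodMk hg))
  refine h.congr ?_
  filter_upwards [H] with s hs
  simp [Bary.integ, hs.2, map_sum, max_eq_left (hs.1 _)]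

/-- A map `𝓑(X) × T → 𝓑(Y)` is continuous if it preserves continuous local sums. -/
theorem continuous_of_locSumAt [LocallyCompactSpace T] {G : Bary X × T → Bary Y}
    (h : ∀ (n : ℕ) (f : (stdSimplex ℝ (Fin n) × (Fin n → X)) × T → Bary X) (p),
      LocSumAt (fun q => (f q).weights) p → LocSumAt (fun q => (G (f q, q.2)).weights) p) :
    Continuous G :=
  continuous_of_formalSum fun n => continuous_iff_continuousAt.2 fun p =>
    continuousAt_of_locSumAt (f := fun q : (stdSimplex ℝ (Fin n) × (Fin n → X)) × T =>
        G (formalSum n q.1, q.2)) (h n (fun q => formalSum n q.1) p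
      (LocSumAt.comp (F := fun q => (Bary.formalSum n q).weights) (LocSumAt.formalSum n p.1)
        continuousAt_fst))

/-- The linear extension of a family of kernels `X → 𝓑(Y)` is jointly continuous. -/
theorem continuous_bind_param [LocallyCompactSpace T] {K : X → T → Bary Y}
    (hK : ∀ x t, LocSumAt (fun q : X × T => (K q.1 q.2).weights) (x, t)) :
    Continuous fun q : Bary X × T => q.1.bind fun x => K x q.2 :=
  continuous_of_locSumAt fun _ _ _ hf =>
    hf.integ continuousAt_snd (K := fun x t => (K x t).weights) hK

theorem continuous_of_locSumAt_unparam {G : Bary X → Bary Y}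
    (h : ∀ (n : ℕ) (f : (stdSimplex ℝ (Fin n) × (Fin n → X)) × Unit → Bary X) (p),
      LocSumAt (fun q => (f q).weights) p → LocSumAt (fun q => (G (f q)).weights) p) :
    Continuous G := by
  have h1 : Continuous fun y : Bary X × Unit => G y.1 := continuous_of_locSumAt h
  have h2 : Continuous fun μ : Bary X => (μ, ()) := by fun_prop
  have h3 := h1.comp h2
  simpa only [Function.comp_def] using h3

theorem continuous_bind {K : X → Bary Y} (hK : ∀ x, LocSumAt (fun x => (K x).weights) x) :
    Continuous fun μ : Bary X => μ.bind K :=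
  continuous_of_locSumAt_unparam fun _ _ _ hf =>
    hf.integ (T := Unit) (g := fun _ => ()) continuousAt_const (K := fun x _ => (K x).weights)
      fun x _ => LocSumAt.comp (f := Prod.fst) (F := fun x => (K x).weights) (hK x) continuousAt_fst

end Continuity

end Bary

/-! ### Homotopies on sets of configurations -/

/-- A homotopy that maps `S` into `S'` at all times restricts to a homotopy of maps `S → S'`. -/
theorem homotopic_of_mapsTo {A B : Type*} [TopologicalSpace A] [TopologicalSpace B] {S : Set A}
    {S' : Set B} {G : A × I → B} (hG : Continuous G) (hm : ∀ a ∈ S, ∀ t, G (a, t) ∈ S')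
    {f g : C(S, S')} (h0 : ∀ a, (f a : B) = G (a, 0)) (h1 : ∀ a, (g a : B) = G (a, 1)) :
    f.Homotopic g :=
  ⟨{ toFun := fun p => ⟨G (p.2, p.1), hm _ p.2.2 _⟩
     continuous_toFun := by fun_prop
     map_zero_left := fun a => Subtype.ext (h0 a).symm
     map_one_left := fun a => Subtype.ext (h1 a).symm }⟩

/-- The homotopy equivalence with given inverse maps. -/
theorem nonempty_homotopyEquiv {A B : Type*} [TopologicalSpace A] [TopologicalSpace B]
    (f : C(A, B)) (g : C(B, A)) (h : (g.comp f).Homotopic (.id A))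
    (h' : (f.comp g).Homotopic (.id B)) : Nonempty (A ≃ₕ B) :=
  ⟨⟨f, g, h, h'⟩⟩

/-- Configurations whose points have at most `n` different images under `π`. -/
def mergedBary {X : Type u} {X' : Type w} (π : X → X') (n : ℕ) : Set (Bary X) :=
  open scoped Classical in {μ | (μ.support.image π).card ≤ n}

theorem mergedBary_id (X : Type u) (n : ℕ) : mergedBary (id : X → X) n = baryFiltration X n := by
  simp [mergedBary, baryFiltration]

namespace Bary

variable {X : Type u} {Y : Type v} {X' Y' : Type*}

theorem mem_mergedBary_of_subset {π : X → X'} {n : ℕ} {μ ν : Bary X} (hν : ν ∈ mergedBary π n)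
    (h : ∀ x ∈ μ.support, ∃ y ∈ ν.support, π y = π x) : μ ∈ mergedBary π n := by
  classical
  refine le_trans (Finset.card_le_card ?_) hν
  intro z hz
  obtain ⟨x, hx, rfl⟩ := Finset.mem_image.1 hz
  obtain ⟨y, hy, h'⟩ := h x hx
  exact Finset.mem_image.2 ⟨y, hy, h'⟩

/-- The linear extension of `K` maps `mergedBary π n` to `mergedBary π' n` if all points of `K x`
have the same image under `π'`, depending only on `π x`. -/
theorem bind_mem_mergedBary {π : X → X'} {π' : Y → Y'} {K : X → Bary Y} (q : X' → Y')
    (hq : ∀ x, ∀ y ∈ (K x).support, π' y = q (π x)) {n : ℕ} {μ : Bary X}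
    (hμ : μ ∈ mergedBary π n) : μ.bind K ∈ mergedBary π' n := by
  classical
  refine le_trans (le_trans (Finset.card_le_card ?_)
    (Finset.card_image_le (f := q) (s := μ.support.image π))) hμ
  intro z hz
  obtain ⟨y, hy, rfl⟩ := Finset.mem_image.1 hz
  obtain ⟨x, hx, h⟩ := exists_of_mem_support_bind hy
  exact Finset.mem_image.2 ⟨π x, Finset.mem_image_of_mem _ hx, (hq x y h).symm⟩

variable [TopologicalSpace X] [TopologicalSpace Y]

/-- The map `mergedBary π n → mergedBary π' n` given by the linear extension of a kernel. -/
noncomputable def bindMap {π : X → X'} {π' : Y → Y'} (K : X → Bary Y)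
    (hK : ∀ x, LocSumAt (fun x => (K x).weights) x) (q : X' → Y')
    (hq : ∀ x, ∀ y ∈ (K x).support, π' y = q (π x)) (n : ℕ) :
    C(mergedBary π n, mergedBary π' n) :=
  ⟨fun μ => ⟨μ.1.bind K, bind_mem_mergedBary q hq μ.2⟩,
    ((continuous_bind hK).comp continuous_subtype_val).subtype_mk _⟩

@[simp] theorem coe_bindMap {π : X → X'} {π' : Y → Y'} (K : X → Bary Y)
    (hK : ∀ x, LocSumAt (fun x => (K x).weights) x) (q : X' → Y')
    (hq : ∀ x, ∀ y ∈ (K x).support, π' y = q (π x)) (n : ℕ) (μ : mergedBary π n) :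
    (bindMap K hK q hq n μ : Bary Y) = μ.1.bind K := rfl

theorem homotopic_of_bind {π : X → X'} {π' : Y → Y'} (K : X → I → Bary Y)
    (hK : ∀ x t, LocSumAt (fun p : X × I => (K p.1 p.2).weights) (x, t)) (q : I → X' → Y')
    (hq : ∀ t x, ∀ y ∈ (K x t).support, π' y = q t (π x)) {n : ℕ}
    {f g : C(mergedBary π n, mergedBary π' n)} (hf : ∀ μ, (f μ : Bary Y) = μ.1.bind (K · 0))
    (hg : ∀ μ, (g μ : Bary Y) = μ.1.bind (K · 1)) : f.Homotopic g :=
  homotopic_of_mapsTo (continuous_bind_param hK)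
    (fun _ hμ t => bind_mem_mergedBary (q t) (hq t) hμ) hf hg

/-- The spaces `𝓑ₙ` are homotopy invariant. -/
theorem baryFiltration_homotopyEquiv (e : X ≃ₕ Y) (n : ℕ) :
    Nonempty (baryFiltration X n ≃ₕ baryFiltration Y n) := by
  rw [← mergedBary_id, ← mergedBary_id]
  obtain ⟨f, g, ⟨H⟩, ⟨H'⟩⟩ := e
  refine nonempty_homotopyEquiv
    (bindMap (fun x => dirac (f x)) (fun x => .dirac f.continuous.continuousAt) f (by simp) n)
    (bindMap (fun x => dirac (g x)) (fun x => .dirac g.continuous.continuousAt) g (by simp) n)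
    ?_ ?_
  · refine homotopic_of_bind (fun x t => dirac (H (t, x)))
      (fun x t => .dirac (g := fun p : X × I => H (p.2, p.1)) (by fun_prop))
      (fun t x => H (t, x)) (by simp) (fun μ => ?_) fun μ => ?_
    · simp [bind_bind, dirac_bind]
    · simpa using (bind_dirac _).symm
  · refine homotopic_of_bind (fun x t => dirac (H' (t, x)))
      (fun x t => .dirac (g := fun p : Y × I => H' (p.2, p.1)) (by fun_prop))
      (fun t x => H' (t, x)) (by simp) (fun μ => ?_) fun μ => ?_
    · simp [bind_bind, dirac_bind]
    · simpa using (bind_dirac _).symm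

/-- A set of configurations that is star-shaped about a point is contractible. -/
theorem contractibleSpace_of_starShaped {S : Set (Bary X)} (p : X) (hp : dirac p ∈ S)
    (h : ∀ μ ∈ S, ∀ t, mix t μ (dirac p) ∈ S) : ContractibleSpace S := by
  refine (contractible_iff_id_nullhomotopic S).2 ⟨⟨dirac p, hp⟩, ?_⟩
  refine homotopic_of_mapsTo (continuous_bind_param (K := fun x t => mix t (dirac x) (dirac p))
    fun x t => ?_) (fun μ hμ t => ?_) (fun μ => ?_) fun μ => ?_
  · exact .mix (a := Prod.snd) continuousAt_snd (.dirac continuousAt_fst)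
      (.dirac continuousAt_const)
  · simpa [bind_mix_const] using h μ hμ t
  · change μ.1 = μ.1.bind fun x => mix 0 (dirac x) (dirac p)
    rw [bind_mix_const, mix_zero]
  · change dirac p = μ.1.bind fun x => mix 1 (dirac x) (dirac p)
    rw [bind_mix_const, mix_one]

end Bary

/-! ### Suspensions -/

namespace Suspension

variable {Y : Type u} {Z : Type v} {V : Type w}

/-- The point of the suspension with coordinates `(y, t)`. -/
def cyl (p : Y × I) : Suspension Y := Quot.mk _ (Sum.inl p)

/-- The poles: `pole false` is at `t = 0` and `pole true` at `t = 1`. -/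
def pole (b : Bool) : Suspension Y := Quot.mk _ (Sum.inr b)

theorem cyl_zero (y : Y) : cyl (y, 0) = pole false := Quot.sound (.south y)

theorem cyl_one (y : Y) : cyl (y, 1) = pole true := Quot.sound (.north y)

theorem ind {P : Suspension Y → Prop} (h : ∀ p, P (cyl p)) (h' : ∀ b, P (pole b)) (x) : P x := by
  obtain ⟨p | b⟩ := x
  exacts [h p, h' b]

variable [TopologicalSpace Y] [TopologicalSpace Z] [TopologicalSpace V]

theorem isQuotientMap_mk : IsQuotientMap (Quot.mk (SuspensionRel Y) : _ → Suspension Y) :=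
  isQuotientMap_quot_mk

theorem continuous_cyl : Continuous (cyl : Y × I → Suspension Y) :=
  isQuotientMap_mk.continuous.comp continuous_inl

/-- Maps out of the suspension. -/
def desc (g : C(Y × I, Z)) (P : Bool → Z) (h0 : ∀ y, g (y, 0) = P false)
    (h1 : ∀ y, g (y, 1) = P true) : C(Suspension Y, Z) where
  toFun := Quot.lift (Sum.elim g P) (by rintro _ _ (y | y); exacts [h0 y, h1 y])
  continuous_toFun := continuous_quot_lift _ (continuous_sum_dom.2
    ⟨g.continuous, continuous_of_discreteTopology⟩)

@[simp] theorem desc_cyl (g : C(Y × I, Z)) (P : Bool → Z) (h0 : ∀ y, g (y, 0) = P false)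
    (h1 : ∀ y, g (y, 1) = P true) (p : Y × I) : desc g P h0 h1 (cyl p) = g p := rfl

@[simp] theorem desc_pole (g : C(Y × I, Z)) (P : Bool → Z) (h0 : ∀ y, g (y, 0) = P false)
    (h1 : ∀ y, g (y, 1) = P true) (b : Bool) : desc g P h0 h1 (pole b) = P b := rfl

/-- Homotopies of maps out of the suspension can be given on the cylinder and on the poles. -/
theorem homotopic_of_cyl {f g : C(Suspension Y, Z)} {G : (Y × I) × I → Z} (hG : Continuous G)
    {P : Bool → I → Z} (hP : ∀ b, Continuous (P b)) (h0 : ∀ y s, G ((y, 0), s) = P false s)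
    (h1 : ∀ y s, G ((y, 1), s) = P true s) (hf : ∀ p, f (cyl p) = G (p, 0))
    (hf' : ∀ b, f (pole b) = P b 0) (hg : ∀ p, g (cyl p) = G (p, 1))
    (hg' : ∀ b, g (pole b) = P b 1) : f.Homotopic g := by
  let R : Suspension Y × I → Z := fun q =>
    Quot.lift (Sum.elim (fun p => G (p, q.2)) fun b => P b q.2)
      (by rintro _ _ (y | y); exacts [h0 y q.2, h1 y q.2]) q.1
  have hR : Continuous R := by
    refine isQuotientMap_mk.continuous_lift_prod_left ?_
    have h : Continuous ((Sum.elim G fun q : Bool × I => P q.1 q.2) ∘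
        (Homeomorph.sumProdDistrib : ((Y × I) ⊕ Bool) × I ≃ₜ _)) := by
      refine (hG.sumElim ?_).comp (Homeomorph.continuous _)
      exact continuous_prod_of_discrete_left.2 hP
    refine h.congr ?_
    rintro ⟨p | b, s⟩ <;> rfl
  refine ⟨⟨⟨fun q => R (q.2, q.1), by fun_prop⟩, ?_, ?_⟩⟩
  · exact ind (fun p => (hf p).symm) fun b => (hf' b).symm
  · exact ind (fun p => (hg p).symm) fun b => (hg' b).symm

/-- A homotopy equivalence induces one of suspensions. -/
theorem nonempty_homotopyEquiv (e : Y ≃ₕ Z) : Nonempty (Suspension Y ≃ₕ Suspension Z) := by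
  obtain ⟨f, g, ⟨H⟩, ⟨H'⟩⟩ := e
  have key : ∀ {A : Type u} {B : Type v} [TopologicalSpace A] [TopologicalSpace B] (f : C(A, B)),
      Continuous fun p : A × I => (cyl (f p.1, p.2) : Suspension B) := fun f =>
    continuous_cyl.comp (by fun_prop)
  have key' : ∀ {A : Type v} {B : Type u} [TopologicalSpace A] [TopologicalSpace B] (f : C(A, B)),
      Continuous fun p : A × I => (cyl (f p.1, p.2) : Suspension B) := fun f =>
    continuous_cyl.comp (by fun_prop)
  refine _root_.nonempty_homotopyEquiv
    (desc ⟨_, key f⟩ pole (fun y => cyl_zero _) fun y => cyl_one _)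
    (desc ⟨_, key' g⟩ pole (fun y => cyl_zero _) fun y => cyl_one _) ?_ ?_
  · exact homotopic_of_cyl (G := fun p => cyl (H (p.2, p.1.1), p.1.2)) (P := fun b _ => pole b)
      (continuous_cyl.comp (by fun_prop)) (fun b => continuous_const) (fun y s => cyl_zero _)
      (fun y s => cyl_one _) (fun p => by simp) (fun b => by simp) (fun p => by simp)
      (fun b => by simp)
  · exact homotopic_of_cyl (G := fun p => cyl (H' (p.2, p.1.1), p.1.2)) (P := fun b _ => pole b)
      (continuous_cyl.comp (by fun_prop)) (fun b => continuous_const) (fun y s => cyl_zero _)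
      (fun y s => cyl_one _) (fun p => by simp) (fun b => by simp) (fun p => by simp)
      (fun b => by simp)

end Suspension

/-! ### Attaching an arc to two points of a space -/

/-- The gluing relation `p ∼ 0`, `q ∼ 1` on the disjoint union of `X` and the unit interval. -/
inductive ArcRel {X : Type u} (p q : X) : X ⊕ I → X ⊕ I → Prop
  | left : ArcRel p q (Sum.inl p) (Sum.inr 0)
  | right : ArcRel p q (Sum.inl q) (Sum.inr 1)

/-- The space obtained from `X` by attaching an arc from `p` to `q`. -/
def Arc {X : Type u} (p q : X) : Type u := Quot (ArcRel p q)

instance {X : Type u} [TopologicalSpace X] (p q : X) : TopologicalSpace (Arc p q) :=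
  inferInstanceAs (TopologicalSpace (Quot (ArcRel p q)))

namespace Arc

variable {X : Type u} {Z : Type v} {p q : X}

/-- The inclusion of `X`. -/
def pt (x : X) : Arc p q := Quot.mk _ (Sum.inl x)

/-- The attached arc. -/
def seg (t : I) : Arc p q := Quot.mk _ (Sum.inr t)

theorem seg_zero : (seg 0 : Arc p q) = pt p := (Quot.sound .left).symm

theorem seg_one : (seg 1 : Arc p q) = pt q := (Quot.sound .right).symm

theorem ind {P : Arc p q → Prop} (h : ∀ x, P (pt x)) (h' : ∀ t, P (seg t)) (y) : P y := by
  obtain ⟨x | t⟩ := y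
  exacts [h x, h' t]

/-- Functions on the space with an arc attached. -/
def elim (f : X → Z) (g : I → Z) (h0 : f p = g 0) (h1 : f q = g 1) : Arc p q → Z :=
  Quot.lift (Sum.elim f g) (by rintro _ _ (_ | _); exacts [h0, h1])

@[simp] theorem elim_seg {f : X → Z} {g : I → Z} {h0 : f p = g 0} {h1 : f q = g 1} (t : I) :
    elim f g h0 h1 (seg t) = g t := rfl

variable [TopologicalSpace X] [TopologicalSpace Z]

theorem isQuotientMap_mk : IsQuotientMap (Quot.mk (ArcRel p q) : _ → Arc p q) :=
  isQuotientMap_quot_mk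

@[fun_prop] theorem continuous_pt : Continuous (pt : X → Arc p q) :=
  isQuotientMap_mk.continuous.comp continuous_inl

@[fun_prop] theorem continuous_seg : Continuous (seg : I → Arc p q) :=
  isQuotientMap_mk.continuous.comp continuous_inr

theorem continuous_elim {f : X → Z} {g : I → Z} {h0 : f p = g 0} {h1 : f q = g 1}
    (hf : Continuous f) (hg : Continuous g) : Continuous (elim f g h0 h1) :=
  continuous_quot_lift _ (hf.sumElim hg)

/-- Homotopies of maps out of `Arc p q` can be given on `X` and on the arc. -/
theorem homotopic_of_parts {f g : C(Arc p q, Z)} {G : X × I → Z} (hG : Continuous G)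
    {P : I × I → Z} (hP : Continuous P) (h0 : ∀ s, G (p, s) = P (0, s))
    (h1 : ∀ s, G (q, s) = P (1, s)) (hf : ∀ x, f (pt x) = G (x, 0))
    (hf' : ∀ t, f (seg t) = P (t, 0)) (hg : ∀ x, g (pt x) = G (x, 1))
    (hg' : ∀ t, g (seg t) = P (t, 1)) : f.Homotopic g := by
  let R : Arc p q × I → Z := fun y =>
    elim (fun x => G (x, y.2)) (fun t => P (t, y.2)) (h0 y.2) (h1 y.2) y.1
  have hR : Continuous R := by
    refine isQuotientMap_mk.continuous_lift_prod_left ?_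
    have h : Continuous ((Sum.elim G P) ∘ (Homeomorph.sumProdDistrib : (X ⊕ I) × I ≃ₜ _)) :=
      (hG.sumElim hP).comp (Homeomorph.continuous _)
    refine h.congr ?_
    rintro ⟨p | b, s⟩ <;> rfl
  refine ⟨⟨⟨fun q => R (q.2, q.1), by fun_prop⟩, ?_, ?_⟩⟩
  · exact ind (fun x => (hf x).symm) fun t => (hf' t).symm
  · exact ind (fun x => (hg x).symm) fun t => (hg' t).symm

variable (p q) in
/-- The attached arc, as a path. -/
def path : Path (pt p : Arc p q) (pt q) where
  toFun := seg
  source' := seg_zero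
  target' := seg_one

/-- The map that is `f` on `X` and traverses the path `β` on the arc. -/
def desc (f : C(X, Z)) (β : Path (f p) (f q)) : C(Arc p q, Z) :=
  ⟨elim f β β.source.symm β.target.symm, continuous_elim f.continuous β.continuous⟩

theorem desc_homotopic {f : C(X, Z)} {β β' : Path (f p) (f q)} (h : β.Homotopic β') :
    (desc f β).Homotopic (desc f β') := by
  obtain ⟨F⟩ := h
  exact homotopic_of_parts (G := fun a => f a.1) (P := fun a => F (a.2, a.1)) (by fun_prop)
    (by fun_prop) (fun s => (F.source s).symm) (fun s => (F.target s).symm) (fun x => rfl)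
    (fun t => by simp [desc]) (fun x => rfl) fun t => by simp [desc]

/-- Moving the ends of the arc along two paths in `X`. -/
noncomputable def shift {p' q' : X} (γ : Path p p') (δ : Path q q') : C(Arc p q, Arc p' q') :=
  desc ⟨pt, continuous_pt⟩ ((γ.map continuous_pt).trans
    ((path p' q').trans (δ.symm.map continuous_pt)))

theorem _root_.Path.Homotopic.conj_conj {Z : Type*} [TopologicalSpace Z] {x y z t : Z}
    (γ : Path x y) (α : Path x z) (δ : Path z t) :
    (γ.trans ((γ.symm.trans (α.trans δ)).trans δ.symm)).Homotopic α := by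
  rw [← Path.Homotopic.Quotient.eq]
  simp only [Path.Homotopic.Quotient.mk_trans, Path.Homotopic.Quotient.mk_symm]
  rw [Path.Homotopic.Quotient.trans_assoc, Path.Homotopic.Quotient.trans_assoc,
    Path.Homotopic.Quotient.trans_symm, Path.Homotopic.Quotient.trans_refl,
    ← Path.Homotopic.Quotient.trans_assoc, Path.Homotopic.Quotient.trans_symm,
    Path.Homotopic.Quotient.refl_trans]

theorem shift_comp_shift {p' q' : X} (γ : Path p p') (δ : Path q q') :
    ((shift γ.symm δ.symm).comp (shift γ δ)).Homotopic (.id _) := by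
  have h1 : (shift γ.symm δ.symm).comp (shift γ δ) = desc (⟨pt, continuous_pt⟩ : C(X, Arc p q))
      ((γ.map continuous_pt).trans ((((γ.map continuous_pt).symm.trans
        ((path p q).trans (δ.map continuous_pt)))).trans (δ.map continuous_pt).symm)) := by
    ext y
    revert y
    refine ind (fun x => rfl) (fun t => ?_)
    have h2 : (((γ.map (continuous_pt (p := p') (q := q'))).trans ((path p' q').trans
        (δ.symm.map continuous_pt))).map (shift γ.symm δ.symm).continuous) =
      ((γ.map continuous_pt).trans ((((γ.map continuous_pt).symm.trans
        ((path p q).trans (δ.map continuous_pt)))).trans (δ.map continuous_pt).symm)) := by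
      have h4 : (path p' q').map (shift γ.symm δ.symm).continuous =
          (γ.symm.map continuous_pt).trans
            ((path p q).trans (δ.symm.symm.map continuous_pt)) := by
        ext; rfl
      rw [Path.map_trans, Path.map_trans, h4, Path.symm_symm]
      rfl
    exact congrArg (fun π : Path (pt p : Arc p q) (pt q) => π t) h2
  have h3 : (.id _ : C(Arc p q, Arc p q)) = desc ⟨pt, continuous_pt⟩ (path p q) := by
    ext y
    revert y
    exact ind (fun x => rfl) (fun t => rfl)
  rw [h1, h3]
  exact desc_homotopic (Path.Homotopic.conj_conj _ _ _)

/-- Attaching an arc at points in the same path components gives homotopy equivalent spaces. -/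
theorem homotopyEquiv_of_joined {p' q' : X} (hp : Joined p p') (hq : Joined q q') :
    Nonempty (Arc p q ≃ₕ Arc p' q') := by
  obtain ⟨γ⟩ := hp
  obtain ⟨δ⟩ := hq
  exact nonempty_homotopyEquiv (shift γ δ) (shift γ.symm δ.symm) (shift_comp_shift γ δ)
    (by simpa using shift_comp_shift γ.symm δ.symm)

end Arc

/-! ### Wedges -/

namespace Wedge

variable {Y : Type u} {Z : Type v} {V : Type w} {y₀ : Y} {z₀ : Z}

/-- The projection from the disjoint union. -/
def mk (a : Y ⊕ Z) : Wedge y₀ z₀ := Quot.mk _ a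

theorem mk_inl_eq_mk_inr : (mk (.inl y₀) : Wedge y₀ z₀) = mk (.inr z₀) :=
  Quot.sound ⟨rfl, rfl⟩

theorem ind {P : Wedge y₀ z₀ → Prop} (h : ∀ a, P (mk a)) (x) : P x := by
  obtain ⟨a⟩ := x
  exact h a

/-- Functions on the wedge. -/
def elim (f : Y ⊕ Z → V) (h : f (.inl y₀) = f (.inr z₀)) : Wedge y₀ z₀ → V :=
  Quot.lift f (by rintro _ _ ⟨rfl, rfl⟩; exact h)

variable [TopologicalSpace Y] [TopologicalSpace Z] [TopologicalSpace V]

theorem isQuotientMap_mk : IsQuotientMap (mk : Y ⊕ Z → Wedge y₀ z₀) := isQuotientMap_quot_mk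

@[fun_prop] theorem continuous_mk : Continuous (mk : Y ⊕ Z → Wedge y₀ z₀) :=
  isQuotientMap_mk.continuous

theorem continuous_elim {f : Y ⊕ Z → V} {h : f (.inl y₀) = f (.inr z₀)} (hf : Continuous f) :
    Continuous (elim f h) := continuous_quot_lift _ hf

end Wedge

/-- The loop in `Arc p p` formed by the arc, as a map from the circle. -/
noncomputable def Arc.loop {X : Type u} (p : X) (z : Circle) : Arc p p :=
  AddCircle.liftIco 1 0 (fun t : ℝ => (Arc.seg (Set.projIcc 0 1 zero_le_one t) : Arc p p))
    ((AddCircle.homeomorphCircle one_ne_zero).symm z)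

theorem Arc.loop_homeomorphCircle {X : Type u} (p : X) (t : I) :
    Arc.loop p (AddCircle.homeomorphCircle one_ne_zero (t : ℝ)) = Arc.seg t := by
  rw [Arc.loop, Homeomorph.symm_apply_apply]
  rcases eq_or_lt_of_le t.2.2 with h | h
  · have h1 : t = 1 := Subtype.ext h
    have h2 : ((1 : ℝ) : AddCircle (1 : ℝ)) = ((0 : ℝ) : AddCircle (1 : ℝ)) := by
      simp
    rw [h, h2, AddCircle.liftIco_zero_coe_apply (by simp), h1, Arc.seg_one, ← Arc.seg_zero]
    congr 1
    exact Set.projIcc_left (zero_le_one' ℝ)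
  · rw [AddCircle.liftIco_zero_coe_apply ⟨t.2.1, h⟩, Set.projIcc_val]

theorem Arc.continuous_loop {X : Type u} [TopologicalSpace X] (p : X) :
    Continuous (Arc.loop p) := by
  refine Continuous.comp (AddCircle.liftIco_zero_continuous ?_ ?_) (Homeomorph.continuous _)
  · rw [Set.projIcc_left, Set.projIcc_right]
    exact Arc.seg_zero.trans Arc.seg_one.symm
  · exact (Arc.continuous_seg.comp continuous_projIcc).continuousOn

theorem Arc.loop_one {X : Type u} (p : X) : Arc.loop p 1 = Arc.pt p := by
  have h := Arc.loop_homeomorphCircle p 0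
  rw [Arc.seg_zero] at h
  rw [← h]
  congr 1
  simp [AddCircle.homeomorphCircle_apply]

/-- Attaching an arc to `A ⊔ B` at two equal points `a` of `A` is the same as wedging a circle to
`A`. -/
theorem Arc.homotopyEquiv_wedge_circle {A : Type u} {B : Type v} [TopologicalSpace A]
    [TopologicalSpace B] (a : A) :
    Nonempty (Arc (Sum.inl a : A ⊕ B) (Sum.inl a) ≃ₕ (Wedge a (1 : Circle) ⊕ B)) := by
  let f : Arc (Sum.inl a : A ⊕ B) (Sum.inl a) → Wedge a (1 : Circle) ⊕ B :=
    Arc.elim (Sum.elim (fun x => .inl (Wedge.mk (.inl x))) .inr)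
      (fun t => .inl (Wedge.mk (.inr (AddCircle.homeomorphCircle one_ne_zero (t : ℝ)))))
      (by simp [Wedge.mk_inl_eq_mk_inr, AddCircle.homeomorphCircle_apply])
      (by
        have h2 : ((1 : ℝ) : AddCircle (1 : ℝ)) = ((0 : ℝ) : AddCircle (1 : ℝ)) := by
          simp
        simp [Wedge.mk_inl_eq_mk_inr, AddCircle.homeomorphCircle_apply, h2])
  let g : Wedge a (1 : Circle) ⊕ B → Arc (Sum.inl a : A ⊕ B) (Sum.inl a) :=
    Sum.elim (Wedge.elim (Sum.elim (fun x => Arc.pt (.inl x)) (Arc.loop _))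
      (Arc.loop_one _).symm) fun y => Arc.pt (.inr y)
  have hf : Continuous f := by
    refine Arc.continuous_elim (Continuous.sumElim (by fun_prop) (by fun_prop)) ?_
    refine continuous_inl.comp (Wedge.continuous_mk.comp (continuous_inr.comp ?_))
    exact (Homeomorph.continuous _).comp
      ((AddCircle.continuous_mk' (1 : ℝ)).comp continuous_subtype_val)
  have hg : Continuous g := by
    refine Continuous.sumElim (Wedge.continuous_elim (Continuous.sumElim (by fun_prop) ?_))
      (by fun_prop)
    exact Arc.continuous_loop _
  have hgf : ∀ y, g (f y) = y :=
    Arc.ind (by rintro (x | y) <;> rfl) fun t => Arc.loop_homeomorphCircle _ t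
  have hfg : ∀ y, f (g y) = y := by
    rintro (y | y)
    · revert y
      refine Wedge.ind ?_
      rintro (x | z)
      · rfl
      · obtain ⟨t, ht, hz⟩ : (AddCircle.homeomorphCircle one_ne_zero).symm z ∈
            ((↑) : ℝ → AddCircle (1 : ℝ)) '' Set.Ico 0 (0 + 1) := by
          rw [AddCircle.coe_image_Ico_eq]; trivial
        rw [zero_add] at ht
        have hz' : AddCircle.homeomorphCircle one_ne_zero (t : AddCircle (1 : ℝ)) = z := by
          rw [hz, Homeomorph.apply_symm_apply]
        have h3 := Arc.loop_homeomorphCircle (Sum.inl a : A ⊕ B) ⟨t, ht.1, ht.2.le⟩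
        change f (Arc.loop _ z) = _
        rw [← hz', h3]
        rfl
    · rfl
  refine nonempty_homotopyEquiv ⟨f, hf⟩ ⟨g, hg⟩ ?_ ?_
  · rw [show (ContinuousMap.comp ⟨g, hg⟩ ⟨f, hf⟩ : C(_, _)) = .id _ from ContinuousMap.ext hgf]
  · rw [show (ContinuousMap.comp ⟨f, hf⟩ ⟨g, hg⟩ : C(_, _)) = .id _ from ContinuousMap.ext hfg]

/-! ### Neighborhood deformations of two points -/

theorem IsNondegeneratePt.inl {A : Type u} {B : Type v} [TopologicalSpace A] [TopologicalSpace B]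
    {p : A} (h : IsNondegeneratePt p) : IsNondegeneratePt (Sum.inl p : A ⊕ B) := by
  obtain ⟨φ, H, h0, h1, h2, h3⟩ := h
  have hH : Continuous (Sum.elim (fun a : A × I => (Sum.inl (H a) : A ⊕ B))
      (fun b : B × I => Sum.inr b.1) ∘ (Homeomorph.sumProdDistrib : (A ⊕ B) × I ≃ₜ _)) :=
    (Continuous.sumElim (by fun_prop) (by fun_prop)).comp (Homeomorph.continuous _)
  refine ⟨⟨Sum.elim φ fun _ => 1, φ.continuous.sumElim continuous_const⟩, ⟨_, hH⟩, ?_, ?_, ?_, ?_⟩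
  · ext (x | y)
    · simpa using Set.ext_iff.1 h0 x
    · simp
  · rintro (x | y)
    · exact congrArg Sum.inl (h1 x)
    · rfl
  · exact fun t => congrArg Sum.inl (h2 t)
  · rintro (x | y) hx
    · exact congrArg Sum.inl (h3 x hx)
    · exact absurd hx (lt_irrefl _)

theorem IsNondegeneratePt.of_homeomorph {A : Type u} {B : Type v} [TopologicalSpace A]
    [TopologicalSpace B] (e : A ≃ₜ B) {p : A} (h : IsNondegeneratePt p) :
    IsNondegeneratePt (e p) := by
  obtain ⟨φ, H, h0, h1, h2, h3⟩ := h
  refine ⟨⟨fun y => φ (e.symm y), by fun_prop⟩, ⟨fun y => e (H (e.symm y.1, y.2)), by fun_prop⟩,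
    ?_, ?_, ?_, ?_⟩
  · ext y
    have := Set.ext_iff.1 h0 (e.symm y)
    simpa [e.symm_apply_eq] using this
  · simp [h1]
  · simp [h2]
  · intro y hy
    simp [h3 _ hy]

theorem IsNondegeneratePt.inr {A : Type u} {B : Type v} [TopologicalSpace A] [TopologicalSpace B]
    {p : B} (h : IsNondegeneratePt p) : IsNondegeneratePt (Sum.inr p : A ⊕ B) :=
  (h.inl (B := A)).of_homeomorph (Homeomorph.sumComm B A)

/-- A deformation `h` of `X` fixing `p` and `q`, with bump functions `c₁`, `c₂` around `p` and `q`: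
no point lies in the supports of both, and `h` moves the points with `c₁ ≠ 0` to `p`, those with
`c₂ ≠ 0` to `q`. -/
structure NDRPair {X : Type u} [TopologicalSpace X] (p q : X) where
  /-- The bump function at `p`. -/
  c₁ : C(X, I)
  /-- The bump function at `q`. -/
  c₂ : C(X, I)
  /-- The deformation. -/
  h : C(X × I, X)
  h_zero : ∀ x, h (x, 0) = x
  h_left : ∀ t, h (p, t) = p
  h_right : ∀ t, h (q, t) = q
  c₁_left : c₁ p = 1
  c₂_right : c₂ q = 1
  disj : ∀ x, c₁ x = 0 ∨ c₂ x = 0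
  collapse_left : ∀ x, c₁ x ≠ 0 → h (x, 1) = p
  collapse_right : ∀ x, c₂ x ≠ 0 → h (x, 1) = q

/-- Two different nondegenerate points can be deformed simultaneously: each of the two given
deformations is slowed down to a standstill where the other one acts. -/
theorem IsNondegeneratePt.nonempty_ndrPair {X : Type u} [TopologicalSpace X] {p q : X}
    (hp : IsNondegeneratePt p) (hq : IsNondegeneratePt q) (hpq : p ≠ q) :
    Nonempty (NDRPair p q) := by
  obtain ⟨φ, H, a0, a1, a2, a3⟩ := hp
  obtain ⟨ψ, K, b0, b1, b2, b3⟩ := hq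
  have a0' : ∀ x, φ x = 0 ↔ x = p := fun x => Set.ext_iff.1 a0 x
  have b0' : ∀ x, ψ x = 0 ↔ x = q := fun x => Set.ext_iff.1 b0 x
  have pos : ∀ x, 0 < (φ x : ℝ) + ψ x := by
    intro x
    rcases (φ x).2.1.eq_or_lt with h | h
    · rcases (ψ x).2.1.eq_or_lt with h' | h'
      · exact absurd (((a0' x).1 (Subtype.ext h.symm)).symm.trans ((b0' x).1 (Subtype.ext h'.symm)))
          hpq
      · exact add_pos_of_nonneg_of_pos (φ x).2.1 h'
    · exact add_pos_of_pos_of_nonneg h (ψ x).2.1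
  -- `r` is `0` at `p` and `1` at `q`; the first deformation acts where `r ≤ 1/2`, the second one
  -- where `r ≥ 1/2`.
  let r : X → ℝ := fun x => φ x / (φ x + ψ x)
  have hr : Continuous r :=
    Continuous.div (by fun_prop) (by fun_prop) fun x => (pos x).ne'
  have hrp : r p = 0 := by simp [r, (a0' p).2 rfl]
  have hrq : r q = 1 := by
    have := (pos q).ne'
    simp only [(b0' q).2 rfl, Set.Icc.coe_zero, add_zero] at this
    simp [r, (b0' q).2 rfl, this]
  let pr : ℝ → I := Set.projIcc 0 1 zero_le_one
  have hpr : Continuous pr := continuous_projIcc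
  have pr0 : ∀ y, y ≤ 0 → pr y = 0 := fun y hy => Set.projIcc_of_le_left _ hy
  have pr1 : ∀ y, 1 ≤ y → pr y = 1 := fun y hy => Set.projIcc_of_right_le _ hy
  let h : X × I → X := fun y =>
    if r y.1 ≤ 1 / 2 then H (y.1, y.2 * pr (2 - 4 * r y.1)) else K (y.1, y.2 * pr (4 * r y.1 - 2))
  have hh : Continuous h := by
    refine Continuous.if_le (by fun_prop) (by fun_prop) (by fun_prop) (by fun_prop) ?_
    intro y hy
    rw [hy, pr0 _ (by norm_num), pr0 _ (by norm_num), mul_zero, a1, b1]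
  refine ⟨⟨⟨fun x => σ (φ x) * pr (1 - 4 * r x), by fun_prop⟩,
    ⟨fun x => σ (ψ x) * pr (4 * r x - 3), by fun_prop⟩, ⟨h, hh⟩, ?_, ?_, ?_, ?_, ?_, ?_, ?_, ?_⟩⟩
  · intro x
    simp [h, a1, b1]
  · intro t
    simp [h, hrp, a2]
  · intro t
    simp only [ContinuousMap.coe_mk, h, hrq]
    rw [if_neg (by norm_num), b2]
  · simp [(a0' p).2 rfl, hrp, pr1]
  · simp only [ContinuousMap.coe_mk, (b0' q).2 rfl, hrq, pr1 (4 * 1 - 3) (by norm_num)]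
    simp
  · intro x
    rcases le_total (r x) (1 / 2) with hx | hx
    · right
      simp only [ContinuousMap.coe_mk]
      rw [pr0 _ (by linarith), mul_zero]
    · left
      simp only [ContinuousMap.coe_mk]
      rw [pr0 _ (by linarith), mul_zero]
  · intro x hx
    simp only [ContinuousMap.coe_mk] at hx
    have h1 : r x < 1 / 4 := by
      by_contra! hc
      exact hx (by rw [pr0 _ (by linarith), mul_zero])
    have h2 : φ x < 1 := by
      by_contra! hc
      have : φ x = 1 := le_antisymm (φ x).2.2 hc
      exact hx (by rw [this, unitInterval.symm_one, zero_mul])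
    change (if r x ≤ 1 / 2 then H (x, 1 * pr (2 - 4 * r x)) else _) = p
    rw [if_pos (by linarith), pr1 _ (by linarith), mul_one, a3 x h2]
  · intro x hx
    simp only [ContinuousMap.coe_mk] at hx
    have h1 : 3 / 4 < r x := by
      by_contra! hc
      exact hx (by rw [pr0 _ (by linarith), mul_zero])
    have h2 : ψ x < 1 := by
      by_contra! hc
      have : ψ x = 1 := le_antisymm (ψ x).2.2 hc
      exact hx (by rw [this, unitInterval.symm_one, zero_mul])
    change (if r x ≤ 1 / 2 then _ else K (x, 1 * pr (4 * r x - 2))) = q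
    rw [if_neg (by linarith), pr1 _ (by linarith), mul_one, b3 x h2]

namespace NDRPair

variable {X : Type u} [TopologicalSpace X] {p q : X} (D : NDRPair p q)

/-- The number `1/2`, as an element of the unit interval. -/
noncomputable def half : I := ⟨1 / 2, by norm_num, by norm_num⟩

theorem c₂_left : D.c₂ p = 0 := (D.disj p).resolve_left (by simp [D.c₁_left])

theorem c₁_right : D.c₁ q = 0 := (D.disj q).resolve_right (by simp [D.c₂_right])

theorem ne (D : NDRPair p q) : p ≠ q := by
  rintro rfl
  simpa [D.c₁_left] using D.c₁_right

open scoped Classical in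
/-- At time `s = 0` the deformation of `X` at its end. For `s > 0` the neighborhoods of `p` and `q`
enter the attached arc from its two ends; for `s = 1` both `p` and `q` go to its midpoint. -/
noncomputable def toArc (x : X) (s : I) : Arc p q :=
  if D.c₁ x ≠ 0 then Arc.seg (s * D.c₁ x * half)
  else if D.c₂ x ≠ 0 then Arc.seg (σ (s * D.c₂ x * half))
  else Arc.pt (D.h (x, 1))

theorem toArc_zero (x : X) : D.toArc x 0 = Arc.pt (D.h (x, 1)) := by
  unfold toArc
  split_ifs with h1 h2
  · rw [D.collapse_left x h1]; simp [Arc.seg_zero]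
  · rw [D.collapse_right x h2]; simp [Arc.seg_one]
  · rfl

theorem toArc_left (s : I) : D.toArc p s = Arc.seg (s * half) := by
  simp [toArc, D.c₁_left]

theorem toArc_right (s : I) : D.toArc q s = Arc.seg (σ (s * half)) := by
  simp [toArc, D.c₁_right, D.c₂_right]

theorem symm_half : σ half = half := Subtype.ext (by norm_num [half])

theorem toArc_left_one : D.toArc p 1 = Arc.seg half := by simp [toArc_left]

theorem toArc_right_one : D.toArc q 1 = Arc.seg half := by simp [toArc_right, symm_half]

/-- A point is sent into the arc only if the deformation moves it to `p` or `q`. -/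
theorem toArc_cases (x : X) (s : I) :
    (∃ t, D.toArc x s = Arc.seg t ∧ (D.h (x, 1) = p ∨ D.h (x, 1) = q)) ∨
      D.toArc x s = Arc.pt (D.h (x, 1)) := by
  unfold toArc
  split_ifs with h1 h2
  · exact .inl ⟨_, rfl, .inl (D.collapse_left x h1)⟩
  · exact .inl ⟨_, rfl, .inr (D.collapse_right x h2)⟩
  · exact .inr rfl

theorem continuous_toArc [T1Space X] : Continuous fun y : X × I => D.toArc y.1 y.2 := by
  have closed : ∀ (c : C(X, I)) (z : X), (∀ x, c x ≠ 0 → D.h (x, 1) = z) →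
      ∀ a ∈ frontier {y : X × I | c y.1 ≠ 0}, c a.1 = 0 ∧ D.h (a.1, 1) = z := by
    intro c z hc a ha
    have ho : IsOpen {y : X × I | c y.1 ≠ 0} :=
      isOpen_ne.preimage (c.continuous.comp continuous_fst)
    rw [ho.frontier_eq] at ha
    refine ⟨by simpa using ha.2, ?_⟩
    have hcl : IsClosed {y : X × I | D.h (y.1, 1) = z} :=
      isClosed_singleton.preimage (by fun_prop : Continuous fun y : X × I => D.h (y.1, 1))
    exact closure_minimal (fun y hy => hc y.1 hy) hcl ha.1
  unfold toArc
  refine Continuous.if (fun a ha => ?_) (by fun_prop) (Continuous.if (fun a ha => ?_)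
    (by fun_prop) (by fun_prop))
  · obtain ⟨h1, h2⟩ := closed D.c₁ p D.collapse_left a ha
    rw [if_neg, h1, h2, mul_zero, zero_mul, Arc.seg_zero]
    intro h3
    exact D.ne (h2.symm.trans (D.collapse_right _ h3))
  · obtain ⟨h1, h2⟩ := closed D.c₂ q D.collapse_right a ha
    rw [h1, h2, mul_zero, zero_mul, unitInterval.symm_zero, Arc.seg_one]

/-- The self-map of the space with an arc attached that contracts the arc to its midpoint and
pulls neighborhoods of its ends into the arc. -/
noncomputable def arcCollapse [T1Space X] : C(Arc p q, Arc p q) :=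
  ⟨Arc.elim (fun x => D.toArc x 1) (fun _ => Arc.seg half) D.toArc_left_one D.toArc_right_one,
    Arc.continuous_elim (D.continuous_toArc.comp
      (by fun_prop : Continuous fun x : X => (x, (1 : I)))) continuous_const⟩

/-- The path from `t` (for `s = 0`) to `1/2` (for `s = 1`). -/
noncomputable def toHalf (t s : I) : I :=
  ⟨(1 - s) * t + s * (1 / 2), by
    have h1 := s.2; have h2 := t.2
    constructor
    · have := mul_nonneg (sub_nonneg.2 h1.2) h2.1
      linarith [h1.1]
    · have := mul_le_mul_of_nonneg_left h2.2 (sub_nonneg.2 h1.2)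
      linarith [h1.1]⟩

theorem continuous_toHalf : Continuous fun y : I × I => toHalf y.1 y.2 :=
  Continuous.subtype_mk (by fun_prop) _

theorem arcCollapse_homotopic_id [T1Space X] : D.arcCollapse.Homotopic (.id _) := by
  have hh : Continuous fun x : X => D.h (x, 1) := by fun_prop
  let g : C(Arc p q, Arc p q) :=
    ⟨Arc.elim (fun x => Arc.pt (D.h (x, 1))) Arc.seg (by rw [D.h_left, Arc.seg_zero])
      (by rw [D.h_right, Arc.seg_one]), Arc.continuous_elim (by fun_prop) (by fun_prop)⟩
  have h1 : g.Homotopic D.arcCollapse := by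
    refine Arc.homotopic_of_parts (G := fun y => D.toArc y.1 y.2)
      (P := fun y => Arc.seg (toHalf y.1 y.2)) D.continuous_toArc
      (Arc.continuous_seg.comp continuous_toHalf) (fun s => ?_) (fun s => ?_) (fun x => ?_)
      (fun t => ?_) (fun x => rfl) (fun t => ?_)
    · rw [D.toArc_left]
      exact congrArg Arc.seg (Subtype.ext (by simp [toHalf, half]))
    · rw [D.toArc_right]
      exact congrArg Arc.seg (Subtype.ext (by simp [toHalf, half]; ring))
    · exact (D.toArc_zero x).symm
    · exact congrArg Arc.seg (Subtype.ext (by simp [toHalf]))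
    · exact congrArg Arc.seg (Subtype.ext (by simp [toHalf, half]))
  have h2 : (.id _ : C(Arc p q, Arc p q)).Homotopic g :=
    Arc.homotopic_of_parts (G := fun y => Arc.pt (D.h y)) (P := fun y => Arc.seg y.1)
      (by fun_prop) (by fun_prop) (fun s => by simp only [D.h_left, Arc.seg_zero])
      (fun s => by simp only [D.h_right, Arc.seg_one]) (fun x => by simp [D.h_zero])
      (fun t => rfl) (fun x => rfl) (fun t => rfl)
  exact (h2.trans h1).symm

end NDRPair

/-- The wedge is obtained up to homotopy by joining the base points by an arc. -/
theorem Arc.homotopyEquiv_wedge {A : Type u} {B : Type v} [TopologicalSpace A]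
    [TopologicalSpace B] [T2Space A] [T2Space B] {a : A} {b : B}
    (D : NDRPair (Sum.inl a : A ⊕ B) (Sum.inr b)) :
    Nonempty (Arc (Sum.inl a : A ⊕ B) (Sum.inr b) ≃ₕ Wedge a b) := by
  let f : C(Arc (Sum.inl a : A ⊕ B) (Sum.inr b), Wedge a b) :=
    ⟨Arc.elim Wedge.mk (fun _ => Wedge.mk (.inl a)) rfl Wedge.mk_inl_eq_mk_inr.symm,
      Arc.continuous_elim (by fun_prop) (by fun_prop)⟩
  let g : C(Wedge a b, Arc (Sum.inl a : A ⊕ B) (Sum.inr b)) :=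
    ⟨Wedge.elim (fun x => D.toArc x 1) (D.toArc_left_one.trans D.toArc_right_one.symm),
      Wedge.continuous_elim (D.continuous_toArc.comp
        (by fun_prop : Continuous fun x : A ⊕ B => (x, (1 : I))))⟩
  refine nonempty_homotopyEquiv f g ?_ ?_
  · have : g.comp f = D.arcCollapse := by
      ext y
      revert y
      exact Arc.ind (fun x => rfl) fun t => D.toArc_left_one
    rw [this]
    exact D.arcCollapse_homotopic_id
  · have key : ∀ x, f (D.toArc x 1) = Wedge.mk (D.h (x, 1)) := by
      intro x
      rcases D.toArc_cases x 1 with ⟨t, h, h' | h'⟩ | h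
      · rw [h, h']; rfl
      · rw [h, h']; exact Wedge.mk_inl_eq_mk_inr
      · rw [h]; rfl
    let R : Wedge a b × I → Wedge a b := fun y =>
      Wedge.elim (fun x => Wedge.mk (D.h (x, y.2)))
        (by rw [D.h_left, D.h_right, Wedge.mk_inl_eq_mk_inr]) y.1
    have hR : Continuous R := Wedge.isQuotientMap_mk.continuous_lift_prod_left
      (by fun_prop : Continuous fun y : (A ⊕ B) × I => (Wedge.mk (D.h y) : Wedge a b))
    refine ContinuousMap.Homotopic.symm ⟨⟨⟨fun y => R (y.2, y.1), by fun_prop⟩, ?_, ?_⟩⟩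
    · exact Wedge.ind fun x => congrArg Wedge.mk (D.h_zero x)
    · exact Wedge.ind fun x => (key x).symm

/-! ### Merging two points of a configuration -/

open scoped Classical in
/-- The map that sends `q` to `p` and fixes all other points. -/
noncomputable def merge {X : Type u} (p q : X) (x : X) : X := if x = q then p else x

theorem merge_left {X : Type u} (p q : X) : merge p q p = p := by simp [merge]

theorem merge_right {X : Type u} (p q : X) : merge p q q = p := by simp [merge]

theorem merge_cases {X : Type u} (p q x : X) :
    merge p q x = x ∨ (x = q ∧ merge p q x = p) := by
  unfold merge
  split_ifs with h
  exacts [.inr ⟨h, rfl⟩, .inl rfl]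

/-- A map that agrees on `p` and `q` factors through `merge p q`. -/
theorem apply_merge {X : Type u} {V : Type v} {p q : X} {f : X → V} (h : f p = f q) (x : X) :
    f (merge p q x) = f x := by
  rcases merge_cases p q x with h' | ⟨rfl, h'⟩
  · rw [h']
  · rw [h', h]

namespace Arc

variable {X : Type u} {p q : X}

/-- The configuration on `X` belonging to a point of the space with an arc attached: the middle
third of the arc becomes the segment of the convex combinations of `p` and `q`, its outer thirds
become `p` and `q`. -/
noncomputable def spread : Arc p q → Bary X :=
  elim dirac (fun t => mix (Set.projIcc 0 1 zero_le_one (3 * t - 1 : ℝ)) (dirac p) (dirac q))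
    (by simp [Set.projIcc_of_le_left]) (by
      rw [Set.projIcc_of_right_le _ (by norm_num)]; simp)

theorem spread_pt (x : X) : spread (pt x : Arc p q) = dirac x := rfl

theorem support_spread_seg {t : I} {x : X} (hx : x ∈ (spread (seg t : Arc p q)).support) :
    x = p ∨ x = q := by
  classical
  simpa using support_mix_subset _ (dirac p) (dirac q) hx

variable [TopologicalSpace X]

/-- Near `X` the configuration `spread y` is the single point obtained by retracting the ends of
the arc to `p` and `q`, and inside the arc it depends on the coordinate of the arc. -/
theorem locSumAt_spread (hpq : p ≠ q) (y : Arc p q) : LocSumAt (fun y => (spread y).weights) y := by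
  classical
  -- the distance of a point of the arc to the ends
  let γ : Arc p q → ℝ := elim (fun _ => 0) (fun t => min (t : ℝ) (1 - t)) (by simp) (by simp)
  have hγ : Continuous γ := continuous_elim (by fun_prop) (by fun_prop)
  rcases lt_or_ge (γ y) (1 / 3) with hy | hy
  · let r : Arc p q → X := elim id (fun t => if (t : ℝ) < 1 / 2 then p else q) (by simp)
      (by simp; norm_num)
    have hO : IsOpen {y | γ y < 1 / 3} := isOpen_lt hγ continuous_const
    have hr : ContinuousOn r {y | γ y < 1 / 3} := by
      refine isQuotientMap_mk.continuousOn_of_comp hO ?_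
      rintro (x | t) ht
      · exact IsOpenEmbedding.inl.continuousAt_iff.1 (continuousAt_id : ContinuousAt id x)
      · refine IsOpenEmbedding.inr.continuousAt_iff.1 ?_
        have ht : min (t : ℝ) (1 - t) < 1 / 3 := ht
        rcases min_lt_iff.1 ht with h | h
        · have h' : ∀ᶠ s : I in 𝓝 t, (s : ℝ) < 1 / 2 :=
            (isOpen_lt continuous_subtype_val continuous_const).mem_nhds
              (show (t : ℝ) < 1 / 2 by linarith)
          refine (continuousAt_const (y := p)).congr ?_
          filter_upwards [h'] with s hs
          exact (if_pos hs).symm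
        · have h' : ∀ᶠ s : I in 𝓝 t, (1 / 2 : ℝ) < s :=
            (isOpen_lt continuous_const continuous_subtype_val).mem_nhds
              (show 1 / 2 < (t : ℝ) by linarith)
          refine (continuousAt_const (y := q)).congr ?_
          filter_upwards [h'] with s hs
          exact (if_neg hs.le.not_gt).symm
    refine (LocSumAt.dirac (hr.continuousAt (hO.mem_nhds hy))).congr ?_
    filter_upwards [hO.mem_nhds hy] with z
    refine ind (P := fun z => γ z < 1 / 3 → (spread z).weights = (dirac (r z)).weights)
      (fun x _ => rfl) (fun t ht => ?_) z
    have ht : min (t : ℝ) (1 - t) < 1 / 3 := ht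
    change (mix (Set.projIcc 0 1 _ (3 * t - 1 : ℝ)) (dirac p) (dirac q)).weights =
      (dirac (if (t : ℝ) < 1 / 2 then p else q)).weights
    rcases min_lt_iff.1 ht with h | h
    · rw [if_pos (by linarith), Set.projIcc_of_le_left _ (by linarith)]
      exact congrArg weights (mix_zero _ _)
    · rw [if_neg (by linarith), Set.projIcc_of_right_le _ (by linarith)]
      exact congrArg weights (mix_one _ _)
  · -- the coordinate of the arc; its values on `X` are irrelevant
    let κ : Arc p q → ℝ := elim (fun x => if x = q then 1 else 0) (fun t => (t : ℝ))
      (by simp [hpq]) (by simp)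
    have hO : IsOpen {y | 0 < γ y} := isOpen_lt continuous_const hγ
    have hyO : 0 < γ y := by linarith
    have hκ : ContinuousOn κ {y | 0 < γ y} := by
      refine isQuotientMap_mk.continuousOn_of_comp hO ?_
      rintro (x | t) ht
      · exact absurd (show (0 : ℝ) < 0 from ht) (lt_irrefl _)
      · exact IsOpenEmbedding.inr.continuousAt_iff.1
          (continuous_subtype_val.continuousAt : ContinuousAt (fun t : I => (t : ℝ)) t)
    have hκ' := hκ.continuousAt (hO.mem_nhds hyO)
    refine (LocSumAt.mix (a := fun y => Set.projIcc 0 1 zero_le_one (3 * κ y - 1 : ℝ))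
      (f := fun _ => dirac p) (g := fun _ => dirac q)
      (continuous_projIcc.continuousAt.comp ((continuousAt_const.mul hκ').sub continuousAt_const))
      (.dirac continuousAt_const) (.dirac continuousAt_const)).congr ?_
    filter_upwards [hO.mem_nhds hyO] with z
    exact ind (P := fun z => 0 < γ z → (spread z).weights =
      (mix (Set.projIcc 0 1 zero_le_one (3 * κ z - 1 : ℝ)) (dirac p) (dirac q)).weights)
      (fun x hx => absurd hx (lt_irrefl _)) (fun t _ => rfl) z

end Arc

namespace NDRPair

variable {X : Type u} [TopologicalSpace X] {p q : X} (D : NDRPair p q)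

theorem locSumAt_dirac_h (x : X) (t : I) :
    LocSumAt (fun y : X × I => (dirac (D.h (y.1, y.2))).weights) (x, t) :=
  .dirac (g := fun y : X × I => D.h y) D.h.continuous.continuousAt

theorem support_dirac_h (t : I) (x y : X) (hy : y ∈ (dirac (D.h (x, t))).support) :
    merge p q y = merge p q (D.h (merge p q x, t)) := by
  rw [support_dirac, Finset.mem_singleton] at hy
  rw [hy]
  exact (apply_merge (f := fun x => merge p q (D.h (x, t)))
    (by simp only [D.h_left, D.h_right, merge_left, merge_right]) x).symm

/-- Configurations on `X`, counted with `p` and `q` merged, and configurations on the space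
obtained from `X` by joining `p` and `q` by an arc are the same up to homotopy: a point of the arc
corresponds to a convex combination of `p` and `q`. -/
theorem mergedBary_homotopyEquiv [T1Space X] (D : NDRPair p q) (n : ℕ) :
    Nonempty (mergedBary (merge p q) n ≃ₕ baryFiltration (Arc p q) n) := by
  rw [← mergedBary_id]
  have hu : Continuous fun x : X => D.toArc x 1 :=
    D.continuous_toArc.comp (by fun_prop : Continuous fun x : X => (x, (1 : I)))
  have hu1 : D.toArc p 1 = D.toArc q 1 := D.toArc_left_one.trans D.toArc_right_one.symm
  have hmerge : ∀ s x, ∀ y ∈ (Arc.spread (D.toArc x s)).support,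
      merge p q y = merge p q (D.h (merge p q x, 1)) := by
    intro s x y hy
    rw [apply_merge (f := fun x => merge p q (D.h (x, 1)))
      (by simp only [D.h_left, D.h_right, merge_left, merge_right]) x]
    have hpq : ∀ z, z = p ∨ z = q → merge p q z = p := by
      rintro z (rfl | rfl)
      exacts [merge_left _ _, merge_right _ _]
    rcases D.toArc_cases x s with ⟨t, h, h'⟩ | h
    · rw [h] at hy
      rw [hpq _ (Arc.support_spread_seg hy), hpq _ h']
    · rw [h, Arc.spread_pt, support_dirac, Finset.mem_singleton] at hy
      rw [hy]
  let f : C(mergedBary (merge p q) n, mergedBary (id : Arc p q → _) n) :=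
    bindMap (fun x => dirac (D.toArc x 1)) (fun x => .dirac hu.continuousAt) (fun x => D.toArc x 1)
      (by simp [apply_merge (f := fun x => D.toArc x 1) hu1]) n
  let g : C(mergedBary (id : Arc p q → _) n, mergedBary (merge p q) n) :=
    bindMap Arc.spread (Arc.locSumAt_spread D.ne)
      (Arc.elim (merge p q) (fun _ => p) (merge_left p q) (merge_right p q)) (by
        refine Arc.ind (fun x y hy => ?_) fun t y hy => ?_
        · rw [Arc.spread_pt, support_dirac, Finset.mem_singleton] at hy
          rw [hy]; rfl
        · rcases Arc.support_spread_seg hy with rfl | rfl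
          · exact merge_left _ _
          · exact merge_right _ _) n
  refine nonempty_homotopyEquiv f g ?_ ?_
  · let m : C(mergedBary (merge p q) n, mergedBary (merge p q) n) :=
      bindMap (fun x => dirac (D.h (x, 1)))
        (fun x => LocSumAt.dirac (g := fun x => D.h (x, 1)) (by fun_prop))
        (fun x => merge p q (D.h (x, 1))) (D.support_dirac_h 1) n
    have h1 : m.Homotopic (g.comp f) := by
      refine homotopic_of_bind (fun x s => Arc.spread (D.toArc x s)) (fun x s => ?_)
        (fun _ x => merge p q (D.h (x, 1))) hmerge (fun μ => ?_) fun μ => ?_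
      · exact LocSumAt.comp (f := fun y : X × I => D.toArc y.1 y.2)
          (F := fun y => (Arc.spread y).weights) (Arc.locSumAt_spread D.ne _)
          D.continuous_toArc.continuousAt
      · simp only [D.toArc_zero, Arc.spread_pt]
        rfl
      · change (μ.1.bind fun x => dirac (D.toArc x 1)).bind Arc.spread = _
        simp only [bind_bind, dirac_bind]
    have h2 : (ContinuousMap.id (mergedBary (merge p q) n)).Homotopic m :=
      homotopic_of_bind (fun x t => dirac (D.h (x, t))) D.locSumAt_dirac_h
        (fun t x => merge p q (D.h (x, t))) D.support_dirac_h
        (fun μ => by simpa [D.h_zero] using (bind_dirac μ.1).symm) fun μ => rfl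
    exact (h2.trans h1).symm
  · obtain ⟨H⟩ := D.arcCollapse_homotopic_id
    refine homotopic_of_bind (fun y t => dirac (H (t, y)))
      (fun y t => .dirac (g := fun z : Arc p q × I => H (z.2, z.1)) (by fun_prop))
      (fun t y => H (t, y)) (by simp) (fun μ => ?_) fun μ => ?_
    · change (μ.1.bind Arc.spread).bind (fun x => dirac (D.toArc x 1)) = _
      rw [bind_bind]
      congr 1
      ext1 y
      rw [H.apply_zero]
      revert y
      refine Arc.ind (fun x => ?_) fun t => ?_
      · rw [Arc.spread_pt, dirac_bind]; rfl
      · change (mix _ (dirac p) (dirac q)).bind _ = _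
        rw [mix_bind, dirac_bind, dirac_bind, D.toArc_left_one, D.toArc_right_one, mix_self]
        rfl
    · simpa using (bind_dirac μ.1).symm

end NDRPair

/-! ### The union of two cones as a suspension -/

/-- Configurations that have at most `n` points besides `p`. -/
def coneBary {X : Type u} (p : X) (n : ℕ) : Set (Bary X) :=
  open scoped Classical in {μ | (μ.support.erase p).card ≤ n}

namespace Bary

variable {X : Type u} {p q : X} {n : ℕ}

theorem mem_coneBary_of_subset {μ ν : Bary X} (hν : ν ∈ coneBary p n)
    (h : ∀ x ∈ μ.support, x = p ∨ x ∈ ν.support) : μ ∈ coneBary p n := by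
  classical
  refine le_trans (Finset.card_le_card fun x hx => ?_) hν
  rw [Finset.mem_erase] at hx ⊢
  exact ⟨hx.1, (h x hx.2).resolve_left hx.1⟩

theorem dirac_mem_coneBary (p : X) (n : ℕ) : dirac p ∈ coneBary p n := by
  classical
  simp [coneBary]

theorem mem_support_mix {t : I} {μ ν : Bary X} {x : X} (h : x ∈ (mix t μ ν).support) :
    (t ≠ 1 ∧ x ∈ μ.support) ∨ (t ≠ 0 ∧ x ∈ ν.support) := by
  by_contra! hc
  refine mem_support.1 h ?_
  rw [weights_mix, Finsupp.add_apply, Finsupp.smul_apply, Finsupp.smul_apply]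
  have h1 : (1 - t : ℝ) • μ.weights x = 0 := by
    by_cases ht : t = 1
    · simp [ht]
    · have := hc.1 ht
      rw [mem_support, not_not] at this
      rw [this, smul_zero]
  have h2 : (t : ℝ) • ν.weights x = 0 := by
    by_cases ht : t = 0
    · simp [ht]
    · have := hc.2 ht
      rw [mem_support, not_not] at this
      rw [this, smul_zero]
  rw [h1, h2, add_zero]

theorem bind_dirac_mem_coneBary {g : X → X} (hg : g p = p) {μ : Bary X} (hμ : μ ∈ coneBary p n) :
    (μ.bind fun x => dirac (g x)) ∈ coneBary p n := by
  classical
  refine le_trans (le_trans (Finset.card_le_card fun y hy => ?_)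
    (Finset.card_image_le (f := g) (s := μ.support.erase p))) hμ
  rw [Finset.mem_erase] at hy
  obtain ⟨x, hx, h⟩ := exists_of_mem_support_bind hy.2
  rw [support_dirac, Finset.mem_singleton] at h
  refine Finset.mem_image.2 ⟨x, Finset.mem_erase.2 ⟨?_, hx⟩, h.symm⟩
  rintro rfl
  exact hy.1 (h.trans hg)

theorem mergedBary_merge_subset (p q : X) (n : ℕ) :
    mergedBary (merge p q) n ⊆ coneBary p n ∩ coneBary q n := by
  classical
  intro μ hμ
  have key : ∀ z, (z = p ∨ z = q) → μ ∈ coneBary z n := by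
    intro z hz
    have hinj : Set.InjOn (merge p q) (μ.support.erase z : Finset X) := by
      intro x hx y hy h
      have hx := Finset.ne_of_mem_erase hx
      have hy := Finset.ne_of_mem_erase hy
      unfold merge at h
      split_ifs at h <;> grind
    change (μ.support.erase z).card ≤ n
    rw [← Finset.card_image_of_injOn hinj]
    refine le_trans ?_ hμ
    exact Finset.card_le_card (Finset.image_subset_image (Finset.erase_subset _ _))
  exact ⟨key p (.inl rfl), key q (.inr rfl)⟩

theorem mem_mergedBary_of_mem_coneBary {μ : Bary X} (hμ : μ ∈ coneBary p n ∪ coneBary q n)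
    (hp : p ∈ μ.support) (hq : q ∈ μ.support) (hpq : p ≠ q) :
    μ ∈ mergedBary (merge p q) n := by
  classical
  have key : ∀ y z, y ∈ μ.support → y ≠ z → merge p q y = merge p q z → μ ∈ coneBary z n →
      μ ∈ mergedBary (merge p q) n := by
    intro y z hy hyz h hz
    refine le_trans (le_trans (Finset.card_le_card fun x hx => ?_)
      (Finset.card_image_le (f := merge p q) (s := μ.support.erase z))) hz
    obtain ⟨x, hx', rfl⟩ := Finset.mem_image.1 hx
    by_cases hxz : x = z
    · exact Finset.mem_image.2 ⟨y, Finset.mem_erase.2 ⟨hyz, hy⟩, by rw [hxz, h]⟩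
    · exact Finset.mem_image_of_mem _ (Finset.mem_erase.2 ⟨hxz, hx'⟩)
  have hm : merge p q p = merge p q q := by rw [merge_left, merge_right]
  rcases hμ with h | h
  · exact key q p hq hpq.symm hm.symm h
  · exact key p q hp hpq hm h

/-- The clamp of a real number to the unit interval. -/
noncomputable def clamp (y : ℝ) : I := Set.projIcc 0 1 zero_le_one y

theorem continuous_clamp : Continuous clamp := continuous_projIcc (h := zero_le_one)

theorem clamp_of_nonpos {y : ℝ} (h : y ≤ 0) : clamp y = 0 := Set.projIcc_of_le_left _ h

theorem clamp_of_one_le {y : ℝ} (h : 1 ≤ y) : clamp y = 1 := Set.projIcc_of_right_le _ h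

theorem pos_of_clamp_ne_zero {y : ℝ} (h : clamp y ≠ 0) : 0 < y := by
  by_contra! hc
  exact h (clamp_of_nonpos hc)

/-- The path from `p` (at `t = 0`) through `ν` (at `t = 1/2`) to `q` (at `t = 1`). -/
noncomputable def throughPath (p q : X) (ν : Bary X) (t : I) : Bary X :=
  mix (clamp (2 * t - 1)) (mix (clamp (1 - 2 * t)) ν (dirac p)) (dirac q)

theorem throughPath_zero (ν : Bary X) : throughPath p q ν 0 = dirac p := by
  simp [throughPath, clamp_of_nonpos, clamp_of_one_le]

theorem throughPath_one (ν : Bary X) : throughPath p q ν 1 = dirac q := by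
  rw [throughPath, clamp_of_one_le (by norm_num), mix_one]

theorem cases_of_mem_support_throughPath {ν : Bary X} {t : I} {x : X}
    (h : x ∈ (throughPath p q ν t).support) :
    x ∈ ν.support ∨ (x = p ∧ (t : ℝ) < 1 / 2) ∨ (x = q ∧ 1 / 2 < (t : ℝ)) := by
  rcases mem_support_mix h with ⟨-, h⟩ | ⟨h1, h⟩
  · rcases mem_support_mix h with ⟨-, h⟩ | ⟨h1, h⟩
    · exact .inl h
    · refine .inr (.inl ⟨by simpa using h, ?_⟩)
      linarith [pos_of_clamp_ne_zero h1]
  · refine .inr (.inr ⟨by simpa using h, ?_⟩)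
    linarith [pos_of_clamp_ne_zero h1]

theorem locSumAt_throughPath [TopologicalSpace X] {T : Type*} [TopologicalSpace T]
    {f : T → Bary X} {g : T → I} {t₀ : T}
    (hf : LocSumAt (fun t => (f t).weights) t₀) (hg : ContinuousAt g t₀) :
    LocSumAt (fun t => (throughPath p q (f t) (g t)).weights) t₀ := by
  have hg' : ContinuousAt (fun t => (g t : ℝ)) t₀ := continuous_subtype_val.continuousAt.comp hg
  refine LocSumAt.mix (continuous_clamp.continuousAt.comp ?_) (LocSumAt.mix
    (continuous_clamp.continuousAt.comp ?_) hf (.dirac continuousAt_const))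
    (.dirac continuousAt_const)
  · exact (continuousAt_const.mul hg').sub continuousAt_const
  · exact continuousAt_const.sub (continuousAt_const.mul hg')

theorem continuous_throughPath [TopologicalSpace X] :
    Continuous fun y : Bary X × I => throughPath p q y.1 y.2 :=
  continuous_of_locSumAt fun _ _ _ hf => locSumAt_throughPath hf continuousAt_snd

theorem throughPath_mem {ν : Bary X} (hν : ν ∈ mergedBary (merge p q) n) (t : I) :
    throughPath p q ν t ∈ coneBary p n ∪ coneBary q n := by
  obtain ⟨h1, h2⟩ := mergedBary_merge_subset p q n hν
  rcases le_total (t : ℝ) (1 / 2) with ht | ht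
  · refine .inl (mem_coneBary_of_subset h1 fun x hx => ?_)
    rcases cases_of_mem_support_throughPath hx with h | h | h
    exacts [.inr h, .inl h.1, absurd h.2 ht.not_gt]
  · refine .inr (mem_coneBary_of_subset h2 fun x hx => ?_)
    rcases cases_of_mem_support_throughPath hx with h | h | h
    exacts [.inr h, absurd h.2 ht.not_gt, .inl h.1]

end Bary

namespace Suspension

open scoped Classical in
/-- The point with coordinates `(ν, t)` of the suspension of a set `W`; if `ν ∉ W`, then it is a
pole. -/
noncomputable def ofCoords {B : Type u} (W : Set B) (ν : B) (t : I) : Suspension W :=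
  if h : ν ∈ W then cyl (⟨ν, h⟩, t) else pole (decide (t = 1))

variable {B : Type u} {W : Set B}

theorem ofCoords_of_mem {ν : B} (h : ν ∈ W) (t : I) : ofCoords W ν t = cyl (⟨ν, h⟩, t) :=
  dif_pos h

theorem ofCoords_zero (ν : B) : ofCoords W ν 0 = pole false := by
  unfold ofCoords
  split_ifs
  · exact cyl_zero _
  · simp

theorem ofCoords_one (ν : B) : ofCoords W ν 1 = pole true := by
  unfold ofCoords
  split_ifs
  · exact cyl_one _
  · simp

theorem continuousAt_ofCoords [TopologicalSpace B] {T : Type*} [TopologicalSpace T] {f : T → B}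
    {τ : T → I} {t₀ : T} (hf : ContinuousAt f t₀) (hτ : ContinuousAt τ t₀)
    (h : ∀ᶠ t in 𝓝 t₀, f t ∈ W) : ContinuousAt (fun t => ofCoords W (f t) (τ t)) t₀ := by
  classical
  let g : T → W := fun t => if ht : f t ∈ W then ⟨f t, ht⟩ else ⟨f t₀, h.self_of_nhds⟩
  have hg : ContinuousAt g t₀ := by
    rw [IsInducing.subtypeVal.continuousAt_iff]
    refine hf.congr ?_
    filter_upwards [h] with t ht
    simp [g, ht]
  refine (continuous_cyl.continuousAt.comp (hg.prodMk hτ)).congr ?_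
  filter_upwards [h] with t ht
  simp [g, ht, ofCoords_of_mem ht]

end Suspension

namespace NDRPair

variable {X : Type u} [TopologicalSpace X] {p q : X} (D : NDRPair p q)

/-- The mass of a configuration near `p`. -/
noncomputable def e₁ (μ : Bary X) : ℝ := μ.integ fun x => (D.c₁ x : ℝ)

/-- The mass of a configuration near `q`. -/
noncomputable def e₂ (μ : Bary X) : ℝ := μ.integ fun x => (D.c₂ x : ℝ)

theorem continuous_e₁ : Continuous D.e₁ := continuous_integ (by fun_prop)

theorem continuous_e₂ : Continuous D.e₂ := continuous_integ (by fun_prop)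

theorem e₁_nonneg (μ : Bary X) : 0 ≤ D.e₁ μ := integ_nonneg fun x => (D.c₁ x).2.1

theorem e₂_nonneg (μ : Bary X) : 0 ≤ D.e₂ μ := integ_nonneg fun x => (D.c₂ x).2.1

theorem c₁_add_c₂_le (x : X) : (D.c₁ x : ℝ) + D.c₂ x ≤ 1 := by
  rcases D.disj x with h | h
  · simpa [h] using (D.c₂ x).2.2
  · simpa [h] using (D.c₁ x).2.2

/-- The image of a configuration under the deformation at time `t`. -/
noncomputable def push (t : I) (μ : Bary X) : Bary X := μ.bind fun x => dirac (D.h (x, t))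

theorem push_zero (μ : Bary X) : D.push 0 μ = μ := by
  simpa [push, D.h_zero] using bind_dirac μ

theorem h_mem_support_push {μ : Bary X} {x : X} (hx : x ∈ μ.support) :
    D.h (x, 1) ∈ (D.push 1 μ).support :=
  mem_support_bind hx (by simp)

theorem exists_of_e₁_pos {μ : Bary X} (h : 0 < D.e₁ μ) : ∃ x ∈ μ.support, D.c₁ x ≠ 0 := by
  obtain ⟨x, hx, hc⟩ := exists_pos_of_integ_pos h
  exact ⟨x, hx, fun h0 => by simp [h0] at hc⟩

theorem exists_of_e₂_pos {μ : Bary X} (h : 0 < D.e₂ μ) : ∃ x ∈ μ.support, D.c₂ x ≠ 0 := by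
  obtain ⟨x, hx, hc⟩ := exists_pos_of_integ_pos h
  exact ⟨x, hx, fun h0 => by simp [h0] at hc⟩

theorem left_mem_support_push {μ : Bary X} (h : 0 < D.e₁ μ) : p ∈ (D.push 1 μ).support := by
  obtain ⟨x, hx, hc⟩ := D.exists_of_e₁_pos h
  have h' := D.h_mem_support_push hx
  rwa [D.collapse_left x hc] at h'

theorem right_mem_support_push {μ : Bary X} (h : 0 < D.e₂ μ) : q ∈ (D.push 1 μ).support := by
  obtain ⟨x, hx, hc⟩ := D.exists_of_e₂_pos h
  have h' := D.h_mem_support_push hx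
  rwa [D.collapse_right x hc] at h'

/-- The part of the deformed configuration away from `p` and `q`. The deformed configuration is
the sum of this, of `e₁ μ` times `p`, and of `e₂ μ` times `q`. -/
noncomputable def rest (μ : Bary X) : X →₀ ℝ :=
  μ.integ fun x => Finsupp.single (D.h (x, 1)) (1 - (D.c₁ x : ℝ) - D.c₂ x)

theorem rest_nonneg (μ : Bary X) : 0 ≤ D.rest μ :=
  integ_finsupp_nonneg fun x => Finsupp.single_nonneg.2 (by linarith [D.c₁_add_c₂_le x])

theorem mass_rest (μ : Bary X) : mass (D.rest μ) = 1 - D.e₁ μ - D.e₂ μ := by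
  rw [rest, map_integ]
  simp only [mass_single, integ_sub, integ_const]
  rfl

theorem exists_of_rest_ne_zero {μ : Bary X} {x : X} (h : D.rest μ x ≠ 0) :
    ∃ y ∈ μ.support, y ≠ p ∧ y ≠ q ∧ D.h (y, 1) = x := by
  obtain ⟨y, hy, hx⟩ := exists_of_mem_support_integ h
  refine ⟨y, hy, ?_, ?_, ?_⟩
  · rintro rfl
    simp [D.c₁_left, D.c₂_left] at hx
  · rintro rfl
    simp [D.c₁_right, D.c₂_right] at hx
  · by_contra hne
    exact hx (Finsupp.single_eq_of_ne' hne)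

/-- The mass removed at `p` in the definition of `balance`. -/
noncomputable def r₁ (μ : Bary X) : ℝ := min (max (D.e₁ μ - D.e₂ μ) 0) (1 / 2)

/-- The mass removed at `q` in the definition of `balance`. -/
noncomputable def r₂ (μ : Bary X) : ℝ := min (max (D.e₂ μ - D.e₁ μ) 0) (1 / 2)

theorem continuous_r₁ : Continuous D.r₁ :=
  ((D.continuous_e₁.sub D.continuous_e₂).max continuous_const).min continuous_const

theorem continuous_r₂ : Continuous D.r₂ :=
  ((D.continuous_e₂.sub D.continuous_e₁).max continuous_const).min continuous_const

theorem r₁_le (μ : Bary X) : D.r₁ μ ≤ D.e₁ μ := by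
  have h1 := D.e₁_nonneg μ
  have h2 := D.e₂_nonneg μ
  exact (min_le_left _ _).trans (max_le (by linarith) h1)

theorem r₂_le (μ : Bary X) : D.r₂ μ ≤ D.e₂ μ := by
  have h1 := D.e₁_nonneg μ
  have h2 := D.e₂_nonneg μ
  exact (min_le_left _ _).trans (max_le (by linarith) h2)

theorem r₁_add_r₂_le (μ : Bary X) : D.r₁ μ + D.r₂ μ ≤ 1 / 2 := by
  rcases le_total (D.e₁ μ) (D.e₂ μ) with h | h
  · have : D.r₁ μ = 0 := by rw [r₁, max_eq_right (by linarith), min_eq_left (by norm_num)]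
    rw [this, zero_add]
    exact min_le_right _ _
  · have : D.r₂ μ = 0 := by rw [r₂, max_eq_right (by linarith), min_eq_left (by norm_num)]
    rw [this, add_zero]
    exact min_le_right _ _

/-- The deformed configuration, with its masses near `p` and `q` balanced: the larger one of them
is decreased, by at most `1/2`, to make it as close as possible to the smaller one, and then the
coefficients are rescaled. -/
noncomputable def balance (μ : Bary X) : Bary X :=
  ofFinsupp ((1 / (1 - D.r₁ μ - D.r₂ μ)) • (D.rest μ + Finsupp.single p (D.e₁ μ - D.r₁ μ) +
    Finsupp.single q (D.e₂ μ - D.r₂ μ)))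
    (by
      have := D.r₁_add_r₂_le μ
      refine smul_nonneg (one_div_nonneg.2 (by linarith)) (add_nonneg (add_nonneg (D.rest_nonneg μ)
        (Finsupp.single_nonneg.2 ?_)) (Finsupp.single_nonneg.2 ?_))
      · exact sub_nonneg.2 (D.r₁_le μ)
      · exact sub_nonneg.2 (D.r₂_le μ))
    (by
      have := D.r₁_add_r₂_le μ
      rw [map_smul, map_add, map_add, D.mass_rest, mass_single, mass_single, smul_eq_mul,
        one_div, inv_mul_eq_one₀ (by linarith)]
      ring)

theorem weights_balance (μ : Bary X) : (D.balance μ).weights = (1 / (1 - D.r₁ μ - D.r₂ μ)) •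
    (D.rest μ + Finsupp.single p (D.e₁ μ - D.r₁ μ) + Finsupp.single q (D.e₂ μ - D.r₂ μ)) := rfl

theorem locSumAt_push {T : Type*} [TopologicalSpace T] {f : T → Bary X} {g : T → I} {t₀ : T}
    (hf : LocSumAt (fun t => (f t).weights) t₀) (hg : ContinuousAt g t₀) :
    LocSumAt (fun t => (D.push (g t) (f t)).weights) t₀ :=
  hf.integ hg (K := fun x t => (dirac (D.h (x, t))).weights) D.locSumAt_dirac_h

theorem locSumAt_balance {T : Type*} [TopologicalSpace T] {f : T → Bary X} {t₀ : T}
    (hf : LocSumAt (fun t => (f t).weights) t₀) :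
    LocSumAt (fun t => (D.balance (f t)).weights) t₀ := by
  have hc : ContinuousAt f t₀ := continuousAt_of_locSumAt hf
  have h1 := D.continuous_e₁.continuousAt.comp hc
  have h2 := D.continuous_e₂.continuousAt.comp hc
  have h3 := D.continuous_r₁.continuousAt.comp hc
  have h4 := D.continuous_r₂.continuousAt.comp hc
  have hpos : ∀ μ, 0 < 1 - D.r₁ μ - D.r₂ μ := fun μ => by
    have := D.r₁_add_r₂_le μ
    linarith
  have hrest : LocSumAt (fun t => D.rest (f t)) t₀ :=
    hf.integ (T := Unit) (g := fun _ => ()) continuousAt_const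
      (K := fun x _ => Finsupp.single (D.h (x, 1)) (1 - (D.c₁ x : ℝ) - D.c₂ x)) fun x t =>
      LocSumAt.single (c := fun y : X × Unit => 1 - (D.c₁ y.1 : ℝ) - D.c₂ y.1)
        (g := fun y => D.h (y.1, 1)) (by fun_prop) (by fun_prop)
        fun y => by linarith [D.c₁_add_c₂_le y.1]
  simp only [weights_balance]
  refine LocSumAt.smul (continuousAt_const.div ((continuousAt_const.sub h3).sub h4)
    (hpos _).ne') (fun t => one_div_nonneg.2 (hpos _).le) ((hrest.add ?_).add ?_)
  · exact LocSumAt.single (h1.sub h3) continuousAt_const fun t => sub_nonneg.2 (D.r₁_le _)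
  · exact LocSumAt.single (h2.sub h4) continuousAt_const fun t => sub_nonneg.2 (D.r₂_le _)

theorem continuous_push : Continuous fun y : Bary X × I => D.push y.2 y.1 :=
  continuous_of_locSumAt fun _ _ _ hf => D.locSumAt_push hf continuousAt_snd

theorem _root_.Continuous.push {T : Type*} [TopologicalSpace T] {f : T → Bary X} {g : T → I}
    (hf : Continuous f) (hg : Continuous g) : Continuous fun t => D.push (g t) (f t) := by
  have h := D.continuous_push.comp (hf.prodMk hg)
  simpa only [Function.comp_def] using h

theorem continuous_balance : Continuous D.balance :=
  continuous_of_locSumAt_unparam fun _ _ _ hf => D.locSumAt_balance hf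

theorem cases_of_mem_support_balance {μ : Bary X} {x : X} (h : x ∈ (D.balance μ).support) :
    (∃ y ∈ μ.support, y ≠ p ∧ y ≠ q ∧ D.h (y, 1) = x) ∨
      (x = p ∧ D.r₁ μ < D.e₁ μ) ∨ (x = q ∧ D.r₂ μ < D.e₂ μ) := by
  by_contra! hc
  refine mem_support.1 h ?_
  have h1 : D.rest μ x = 0 := by
    by_contra hne
    obtain ⟨y, hy, hp, hq, hx⟩ := D.exists_of_rest_ne_zero hne
    exact hc.1 y hy hp hq hx
  have h2 : Finsupp.single p (D.e₁ μ - D.r₁ μ) x = 0 := by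
    by_cases hx : x = p
    · rw [le_antisymm (D.r₁_le μ) (hc.2.1 hx)]; simp
    · exact Finsupp.single_eq_of_ne hx
  have h3 : Finsupp.single q (D.e₂ μ - D.r₂ μ) x = 0 := by
    by_cases hx : x = q
    · rw [le_antisymm (D.r₂_le μ) (hc.2.2 hx)]; simp
    · exact Finsupp.single_eq_of_ne hx
  rw [weights_balance, Finsupp.smul_apply, Finsupp.add_apply, Finsupp.add_apply, h1, h2, h3]
  simp

theorem support_balance_subset (μ : Bary X) : (D.balance μ).support ⊆ (D.push 1 μ).support := by
  intro x hx
  rcases D.cases_of_mem_support_balance hx with ⟨y, hy, -, -, rfl⟩ | ⟨rfl, h⟩ | ⟨rfl, h⟩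
  · exact D.h_mem_support_push hy
  · exact D.left_mem_support_push
      ((le_min (le_max_right _ _) (by norm_num)).trans_lt h)
  · exact D.right_mem_support_push
      ((le_min (le_max_right _ _) (by norm_num)).trans_lt h)

/-- If the masses near `p` and `q` differ by at most `1/2`, then they become equal in the balanced
configuration, so `p` or `q` can only occur if both masses are positive, or as the image of a point
different from `p` and `q`. -/
theorem cases_of_mem_support_balance_of_abs_le {μ : Bary X} (hd : |D.e₁ μ - D.e₂ μ| ≤ 1 / 2)
    {x : X} (h : x ∈ (D.balance μ).support) :
    (∃ y ∈ μ.support, y ≠ p ∧ y ≠ q ∧ D.h (y, 1) = x) ∨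
      ((x = p ∨ x = q) ∧ 0 < D.e₁ μ ∧ 0 < D.e₂ μ) := by
  have hd := abs_le.1 hd
  have h1 := D.e₁_nonneg μ
  have h2 := D.e₂_nonneg μ
  have key : (D.r₁ μ < D.e₁ μ ∨ D.r₂ μ < D.e₂ μ) → 0 < D.e₁ μ ∧ 0 < D.e₂ μ := by
    rcases le_total (D.e₁ μ) (D.e₂ μ) with hle | hle
    · have hr1 : D.r₁ μ = 0 := by rw [r₁, max_eq_right (by linarith), min_eq_left (by norm_num)]
      have hr2 : D.r₂ μ = D.e₂ μ - D.e₁ μ := by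
        rw [r₂, max_eq_left (by linarith), min_eq_left (by linarith)]
      rintro (h | h)
      · constructor <;> linarith
      · constructor <;> linarith
    · have hr2 : D.r₂ μ = 0 := by rw [r₂, max_eq_right (by linarith), min_eq_left (by norm_num)]
      have hr1 : D.r₁ μ = D.e₁ μ - D.e₂ μ := by
        rw [r₁, max_eq_left (by linarith), min_eq_left (by linarith)]
      rintro (h | h)
      · constructor <;> linarith
      · constructor <;> linarith
  rcases D.cases_of_mem_support_balance h with h | ⟨hx, h⟩ | ⟨hx, h⟩
  · exact .inl h
  · exact .inr ⟨.inl hx, key (.inl h)⟩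
  · exact .inr ⟨.inr hx, key (.inr h)⟩

theorem push_mem_coneBary {n : ℕ} {μ : Bary X} (hμ : μ ∈ coneBary p n ∪ coneBary q n) (t : I) :
    D.push t μ ∈ coneBary p n ∪ coneBary q n :=
  hμ.imp (bind_dirac_mem_coneBary (D.h_left t)) (bind_dirac_mem_coneBary (D.h_right t))

theorem push_mem_mergedBary {n : ℕ} {μ : Bary X} (hμ : μ ∈ mergedBary (merge p q) n) (t : I) :
    D.push t μ ∈ mergedBary (merge p q) n :=
  bind_mem_mergedBary (fun x => merge p q (D.h (x, t))) (D.support_dirac_h t) hμ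

theorem balance_mem_mergedBary {n : ℕ} {μ : Bary X} (hμ : μ ∈ coneBary p n ∪ coneBary q n)
    (hd : |D.e₁ μ - D.e₂ μ| ≤ 1 / 2) : D.balance μ ∈ mergedBary (merge p q) n := by
  classical
  by_cases h : 0 < D.e₁ μ ∧ 0 < D.e₂ μ
  · exact mem_mergedBary_of_subset
      (mem_mergedBary_of_mem_coneBary (D.push_mem_coneBary hμ 1) (D.left_mem_support_push h.1)
        (D.right_mem_support_push h.2) D.ne)
      fun x hx => ⟨x, D.support_balance_subset μ hx, rfl⟩
  · have key : ∀ z, (z = p ∨ z = q) → μ ∈ coneBary z n →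
        D.balance μ ∈ mergedBary (merge p q) n := by
      intro z hz hμz
      refine le_trans (Finset.card_image_le.trans (le_trans (Finset.card_le_card fun x hx => ?_)
        (Finset.card_image_le (f := fun y => D.h (y, 1)) (s := μ.support.erase z)))) hμz
      rcases D.cases_of_mem_support_balance_of_abs_le hd hx with ⟨y, hy, hp, hq, h'⟩ | ⟨-, h'⟩
      · refine Finset.mem_image.2 ⟨y, Finset.mem_erase.2 ⟨?_, hy⟩, h'⟩
        rcases hz with rfl | rfl
        exacts [hp, hq]
      · exact absurd h' h
    rcases hμ with hμ | hμ
    exacts [key p (.inl rfl) hμ, key q (.inr rfl) hμ]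

/-- The suspension coordinate of a configuration: it is `0` if there is much more mass near `p`
than near `q`, and `1` in the opposite case. -/
noncomputable def height (μ : Bary X) : I := clamp (1 / 2 + 2 * (D.e₂ μ - D.e₁ μ))

theorem continuous_height : Continuous D.height :=
  continuous_clamp.comp (continuous_const.add
    (continuous_const.mul (D.continuous_e₂.sub D.continuous_e₁)))

theorem height_eq_zero {μ : Bary X} (h : 1 / 4 ≤ D.e₁ μ - D.e₂ μ) : D.height μ = 0 :=
  clamp_of_nonpos (by linarith)

theorem height_eq_one {μ : Bary X} (h : 1 / 4 ≤ D.e₂ μ - D.e₁ μ) : D.height μ = 1 :=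
  clamp_of_one_le (by linarith)

/-- The map from the union of the two cones to the suspension of their intersection: the base
coordinate is the balanced configuration, the height tells by how much `p` or `q` dominates. -/
noncomputable def toSuspension (n : ℕ) :
    C((coneBary p n ∪ coneBary q n : Set (Bary X)), Suspension (mergedBary (merge p q) n)) where
  toFun μ := Suspension.ofCoords _ (D.balance μ) (D.height μ)
  continuous_toFun := by
    refine continuous_iff_continuousAt.2 fun μ => ?_
    have hb : Continuous fun μ : (coneBary p n ∪ coneBary q n : Set (Bary X)) => D.balance μ :=
      D.continuous_balance.comp continuous_subtype_val
    have hh : Continuous fun μ : (coneBary p n ∪ coneBary q n : Set (Bary X)) => D.height μ :=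
      D.continuous_height.comp continuous_subtype_val
    have he : Continuous fun μ : (coneBary p n ∪ coneBary q n : Set (Bary X)) =>
        D.e₁ μ - D.e₂ μ :=
      (D.continuous_e₁.sub D.continuous_e₂).comp continuous_subtype_val
    rcases lt_or_ge |D.e₁ μ - D.e₂ μ| (1 / 2) with hd | hd
    · refine Suspension.continuousAt_ofCoords hb.continuousAt hh.continuousAt ?_
      filter_upwards [(isOpen_lt he.abs continuous_const).mem_nhds hd] with ν hν
      exact D.balance_mem_mergedBary ν.2 (le_of_lt hν)
    · rcases le_abs.1 hd with hd | hd
      · refine (continuousAt_const (y := Suspension.pole false)).congr ?_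
        filter_upwards [(isOpen_lt continuous_const he).mem_nhds
          (show 1 / 4 < D.e₁ μ - D.e₂ μ by linarith)] with ν hν
        rw [D.height_eq_zero (le_of_lt hν), Suspension.ofCoords_zero]
      · refine (continuousAt_const (y := Suspension.pole true)).congr ?_
        filter_upwards [(isOpen_lt he continuous_const).mem_nhds
          (show D.e₁ μ - D.e₂ μ < -(1 / 4) by linarith)] with ν hν
        have hν : D.e₁ ν - D.e₂ ν < -(1 / 4) := hν
        rw [D.height_eq_one (by linarith), Suspension.ofCoords_one]

variable (p q) in
/-- The map from the suspension to the union of the two cones. -/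
noncomputable def ofSuspension (n : ℕ) :
    C(Suspension (mergedBary (merge p q) n), (coneBary p n ∪ coneBary q n : Set (Bary X))) :=
  Suspension.desc ⟨fun y => ⟨throughPath p q y.1 y.2, throughPath_mem y.1.2 _⟩,
      (continuous_throughPath.comp (by fun_prop : Continuous
        fun y : mergedBary (merge p q) n × I => ((y.1 : Bary X), y.2))).subtype_mk _⟩
    (fun b => if b then ⟨dirac q, .inr (dirac_mem_coneBary q n)⟩
      else ⟨dirac p, .inl (dirac_mem_coneBary p n)⟩)
    (fun ν => Subtype.ext (throughPath_zero _)) (fun ν => Subtype.ext (throughPath_one _))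

theorem coe_ofSuspension_ofCoords {n : ℕ} {ν : Bary X} {t : I}
    (h : ν ∈ mergedBary (merge p q) n ∨ t = 0 ∨ t = 1) :
    (ofSuspension p q n (Suspension.ofCoords _ ν t) : Bary X) = throughPath p q ν t := by
  rcases h with h | rfl | rfl
  · rw [Suspension.ofCoords_of_mem h]; rfl
  · rw [Suspension.ofCoords_zero, throughPath_zero]; rfl
  · rw [Suspension.ofCoords_one, throughPath_one]; rfl

theorem ofSuspension_comp_toSuspension_homotopic (n : ℕ) :
    ((ofSuspension p q n).comp (D.toSuspension n)).Homotopic (.id _) := by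
  let m : C((coneBary p n ∪ coneBary q n : Set (Bary X)),
      (coneBary p n ∪ coneBary q n : Set (Bary X))) :=
    ⟨fun μ => ⟨D.push 1 μ, D.push_mem_coneBary μ.2 1⟩, Continuous.subtype_mk
      (Continuous.push D continuous_subtype_val continuous_const) _⟩
  have h1 : (ContinuousMap.id _).Homotopic m :=
    homotopic_of_mapsTo D.continuous_push (fun μ hμ t => D.push_mem_coneBary hμ t)
      (fun μ => (D.push_zero μ.1).symm) fun μ => rfl
  have hc : Continuous fun y : Bary X × I =>
      mix y.2 (D.push 1 y.1) (throughPath p q (D.balance y.1) (D.height y.1)) :=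
    continuous_of_locSumAt fun n f p hf => LocSumAt.mix continuousAt_snd
      (D.locSumAt_push hf continuousAt_const) (locSumAt_throughPath (D.locSumAt_balance hf)
        (D.continuous_height.continuousAt.comp (continuousAt_of_locSumAt hf)))
  have hsub : ∀ μ, (throughPath p q (D.balance μ) (D.height μ)).support ⊆
      (D.push 1 μ).support := by
    intro μ x hx
    have hh : (D.height μ : ℝ) = max 0 (min 1 (1 / 2 + 2 * (D.e₂ μ - D.e₁ μ))) := rfl
    have h1 := D.e₁_nonneg μ
    have h2 := D.e₂_nonneg μ
    rcases cases_of_mem_support_throughPath hx with h | ⟨rfl, h⟩ | ⟨rfl, h⟩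
    · exact D.support_balance_subset μ h
    · refine D.left_mem_support_push ?_
      by_contra! hc
      have : (1 / 2 : ℝ) ≤ D.height μ := by
        rw [hh]
        exact le_max_of_le_right (le_min (by norm_num) (by linarith))
      linarith
    · refine D.right_mem_support_push ?_
      by_contra! hc
      have : (D.height μ : ℝ) ≤ 1 / 2 := by
        rw [hh]
        exact max_le (by norm_num) ((min_le_right _ _).trans (by linarith))
      linarith
  have h2 : m.Homotopic ((ofSuspension p q n).comp (D.toSuspension n)) := by
    refine homotopic_of_mapsTo hc (fun μ hμ t => ?_) (fun μ => (mix_zero _ _).symm) fun μ => ?_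
    · have hs : (mix t (D.push 1 μ) (throughPath p q (D.balance μ) (D.height μ))).support ⊆
          (D.push 1 μ).support := fun x hx =>
        (mem_support_mix hx).elim (fun h => h.2) fun h => hsub μ h.2
      exact (D.push_mem_coneBary hμ 1).imp
        (fun h => mem_coneBary_of_subset h fun x hx => .inr (hs hx))
        (fun h => mem_coneBary_of_subset h fun x hx => .inr (hs hx))
    · simp only [mix_one]
      refine coe_ofSuspension_ofCoords ?_
      by_cases hd : |D.e₁ μ - D.e₂ μ| ≤ 1 / 2
      · exact .inl (D.balance_mem_mergedBary μ.2 hd)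
      · right
        rcases lt_abs.1 (not_le.1 hd) with h | h
        · exact .inl (D.height_eq_zero (by linarith))
        · exact .inr (D.height_eq_one (by linarith))
  exact (h1.trans h2).symm

/-- On the path from `p` through `ν` to `q`, the balanced configurations involve, up to merging `p`
and `q`, only points of the deformed `ν`. -/
theorem exists_of_mem_support_balance_throughPath {ν : Bary X} {t : I}
    (hd : |D.e₁ (throughPath p q ν t) - D.e₂ (throughPath p q ν t)| ≤ 1 / 2) {x : X}
    (hx : x ∈ (D.balance (throughPath p q ν t)).support) :
    ∃ y ∈ (D.push 1 ν).support, merge p q y = merge p q x := by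
  rcases D.cases_of_mem_support_balance_of_abs_le hd hx with ⟨y, hy, hp, hq, rfl⟩ | ⟨h, h1, h2⟩
  · rcases cases_of_mem_support_throughPath hy with h | h | h
    exacts [⟨_, D.h_mem_support_push h, rfl⟩, absurd h.1 hp, absurd h.1 hq]
  · have hm : merge p q x = p := by
      rcases h with rfl | rfl
      exacts [merge_left _ _, merge_right _ _]
    rw [hm]
    obtain ⟨y, hy, hcy⟩ := D.exists_of_e₁_pos h1
    obtain ⟨z, hz, hcz⟩ := D.exists_of_e₂_pos h2
    rcases cases_of_mem_support_throughPath hy with h | h | h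
    · exact ⟨_, D.h_mem_support_push h, by rw [D.collapse_left y hcy, merge_left]⟩
    · -- `t < 1/2`, so the point near `q` occurs in `ν`
      rcases cases_of_mem_support_throughPath hz with h' | h' | h'
      · exact ⟨_, D.h_mem_support_push h', by rw [D.collapse_right z hcz, merge_right]⟩
      · exact absurd (h'.1 ▸ D.c₂_left) hcz
      · exact absurd h.2 h'.2.le.not_gt
    · exact absurd (h.1 ▸ D.c₁_right) hcy

/-- A cutoff function: it is `1` unless the height is `0` or `1`, and it is `0` where the balanced
configuration may lie outside of the intersection of the two cones. -/
noncomputable def cutoff (μ : Bary X) : I := clamp (2 - 4 * |D.e₁ μ - D.e₂ μ|)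

theorem continuous_cutoff : Continuous D.cutoff :=
  continuous_clamp.comp (continuous_const.sub
    (continuous_const.mul (D.continuous_e₁.sub D.continuous_e₂).abs))

/-- At `s = 0` the deformed configuration `ν`. At `s = 1` the balanced configuration for the point
with parameter `t` on the path from `p` through `ν` to `q`, as long as its height is not `0` or
`1`. -/
noncomputable def interp (ν : Bary X) (t s : I) : Bary X :=
  mix (s * D.cutoff (throughPath p q ν t)) (D.push 1 ν) (D.balance (throughPath p q ν t))

theorem interp_zero (ν : Bary X) (t : I) : D.interp ν t 0 = D.push 1 ν := by
  rw [interp, zero_mul, mix_zero]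

theorem interp_one {ν : Bary X} {t : I}
    (h : |D.e₁ (throughPath p q ν t) - D.e₂ (throughPath p q ν t)| ≤ 1 / 4) :
    D.interp ν t 1 = D.balance (throughPath p q ν t) := by
  rw [interp, cutoff, clamp_of_one_le (by linarith), one_mul, mix_one]

theorem continuous_interp : Continuous fun y : Bary X × (I × I) => D.interp y.1 y.2.1 y.2.2 := by
  refine continuous_of_locSumAt (G := fun y : Bary X × (I × I) => D.interp y.1 y.2.1 y.2.2)
    fun n f a hf => ?_
  have h1 : LocSumAt (fun y : (stdSimplex ℝ (Fin n) × (Fin n → X)) × (I × I) =>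
      (throughPath p q (f y) y.2.1).weights) a :=
    locSumAt_throughPath hf (by fun_prop)
  refine LocSumAt.mix ?_ (D.locSumAt_push hf continuousAt_const) (D.locSumAt_balance h1)
  have h2 : ContinuousAt (fun y : (stdSimplex ℝ (Fin n) × (Fin n → X)) × (I × I) =>
      D.cutoff (throughPath p q (f y) y.2.1)) a :=
    D.continuous_cutoff.continuousAt.comp (continuousAt_of_locSumAt h1)
  have h3 : ContinuousAt (fun y : (stdSimplex ℝ (Fin n) × (Fin n → X)) × (I × I) =>
      y.2.2) a := by fun_prop
  exact h3.mul h2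

theorem interp_mem {n : ℕ} {ν : Bary X} (hν : ν ∈ mergedBary (merge p q) n) (t s : I) :
    D.interp ν t s ∈ mergedBary (merge p q) n := by
  refine mem_mergedBary_of_subset (D.push_mem_mergedBary hν 1) fun x hx => ?_
  rcases mem_support_mix hx with ⟨-, h⟩ | ⟨h0, h⟩
  · exact ⟨x, h, rfl⟩
  · have h' : D.cutoff (throughPath p q ν t) ≠ 0 := fun h => h0 (by rw [h, mul_zero])
    exact D.exists_of_mem_support_balance_throughPath
      (by linarith [pos_of_clamp_ne_zero h']) h

theorem height_dirac_left : D.height (dirac p) = 0 := D.height_eq_zero (by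
  simp [e₁, e₂, integ_dirac, D.c₁_left, D.c₂_left]; norm_num)

theorem height_dirac_right : D.height (dirac q) = 1 := D.height_eq_one (by
  simp [e₁, e₂, integ_dirac, D.c₁_right, D.c₂_right]; norm_num)

/-- The homotopy of the suspension that is given by `interp` on the base and by a straight line
from the height `t` to the height of the point with parameter `t` on the path from `p` through `ν`
to `q`. -/
noncomputable def suspHomotopy (n : ℕ) (y : (mergedBary (merge p q) n × I) × I) :
    mergedBary (merge p q) n × I :=
  (⟨D.interp y.1.1 y.1.2 y.2, D.interp_mem y.1.1.2 _ _⟩,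
    ⟨(1 - y.2) * y.1.2 + y.2 * D.height (throughPath p q y.1.1 y.1.2),
      (convex_Icc (0 : ℝ) 1) y.1.2.2 (D.height _).2 (sub_nonneg.2 y.2.2.2) y.2.2.1 (by simp)⟩)

theorem continuous_suspHomotopy (n : ℕ) : Continuous (D.suspHomotopy n) := by
  refine Continuous.prodMk ?_ ?_
  · have h := D.continuous_interp.comp (by fun_prop : Continuous
      fun y : (mergedBary (merge p q) n × I) × I => ((y.1.1 : Bary X), (y.1.2, y.2)))
    refine Continuous.subtype_mk ?_ _
    simpa only [Function.comp_def] using h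
  · have h0 := D.continuous_height.comp ((continuous_throughPath (p := p) (q := q)).comp
      (by fun_prop : Continuous
        fun y : (mergedBary (merge p q) n × I) × I => ((y.1.1 : Bary X), y.1.2)))
    have h : Continuous fun y : (mergedBary (merge p q) n × I) × I =>
        D.height (throughPath p q y.1.1 y.1.2) := by
      simpa only [Function.comp_def] using h0
    have key : ∀ f : (mergedBary (merge p q) n × I) × I → I, Continuous f →
        Continuous fun y : (mergedBary (merge p q) n × I) × I =>
          (1 - y.2 : ℝ) * y.1.2 + y.2 * f y := fun f hf => by fun_prop
    exact (key _ h).subtype_mk _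

theorem suspHomotopy_south (n : ℕ) (ν : mergedBary (merge p q) n) (s : I) :
    Suspension.cyl (D.suspHomotopy n ((ν, 0), s)) = Suspension.pole false := by
  rw [← Suspension.cyl_zero ⟨_, D.interp_mem ν.2 0 s⟩]
  exact congrArg Suspension.cyl (Prod.ext rfl (Subtype.ext
    (by simp [suspHomotopy, throughPath_zero, D.height_dirac_left])))

theorem suspHomotopy_north (n : ℕ) (ν : mergedBary (merge p q) n) (s : I) :
    Suspension.cyl (D.suspHomotopy n ((ν, 1), s)) = Suspension.pole true := by
  rw [← Suspension.cyl_one ⟨_, D.interp_mem ν.2 1 s⟩]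
  exact congrArg Suspension.cyl (Prod.ext rfl (Subtype.ext
    (by simp [suspHomotopy, throughPath_one, D.height_dirac_right])))

theorem suspHomotopy_zero (n : ℕ) (y : mergedBary (merge p q) n × I) :
    D.suspHomotopy n (y, 0) = (⟨D.push 1 y.1, D.push_mem_mergedBary y.1.2 1⟩, y.2) :=
  Prod.ext (Subtype.ext (D.interp_zero _ _)) (Subtype.ext (by simp [suspHomotopy]))

theorem suspHomotopy_one (n : ℕ) (y : mergedBary (merge p q) n × I) :
    Suspension.cyl (D.suspHomotopy n (y, 1)) = Suspension.ofCoords (mergedBary (merge p q) n)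
      (D.balance (throughPath p q y.1 y.2)) (D.height (throughPath p q y.1 y.2)) := by
  have hy : D.suspHomotopy n (y, 1) =
      (⟨_, D.interp_mem y.1.2 y.2 1⟩, D.height (throughPath p q y.1 y.2)) :=
    Prod.ext rfl (Subtype.ext (by simp [suspHomotopy]))
  rw [hy]
  rcases le_or_gt |D.e₁ (throughPath p q y.1 y.2) - D.e₂ (throughPath p q y.1 y.2)| (1 / 4)
    with hd | hd
  · have h3 := D.interp_one hd
    rw [Suspension.ofCoords_of_mem (h3 ▸ D.interp_mem y.1.2 y.2 1)]
    exact congrArg Suspension.cyl (Prod.ext (Subtype.ext h3) rfl)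
  · rcases lt_abs.1 hd with h | h
    · rw [D.height_eq_zero h.le, Suspension.ofCoords_zero, Suspension.cyl_zero]
    · rw [D.height_eq_one (by linarith), Suspension.ofCoords_one, Suspension.cyl_one]

theorem toSuspension_comp_ofSuspension_homotopic (n : ℕ) :
    ((D.toSuspension n).comp (ofSuspension p q n)).Homotopic (.id _) := by
  have hpush' : Continuous fun y : (mergedBary (merge p q) n × I) × I =>
      (⟨D.push y.2 y.1.1, D.push_mem_mergedBary y.1.1.2 _⟩ : mergedBary (merge p q) n) :=
    (Continuous.push D (f := fun y : (mergedBary (merge p q) n × I) × I => y.1.1.1)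
      (by fun_prop) continuous_snd).subtype_mk _
  let m : C(Suspension (mergedBary (merge p q) n), Suspension (mergedBary (merge p q) n)) :=
    Suspension.desc ⟨fun y => Suspension.cyl (⟨D.push 1 y.1, D.push_mem_mergedBary y.1.2 1⟩, y.2),
      Suspension.continuous_cyl.comp ((hpush'.comp (by fun_prop : Continuous
        fun y : mergedBary (merge p q) n × I => (y, (1 : I)))).prodMk continuous_snd)⟩
      Suspension.pole (fun _ => Suspension.cyl_zero _) fun _ => Suspension.cyl_one _
  have h1 : (ContinuousMap.id (Suspension (mergedBary (merge p q) n))).Homotopic m := by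
    refine Suspension.homotopic_of_cyl (G := fun y => Suspension.cyl
      (⟨D.push y.2 y.1.1, D.push_mem_mergedBary y.1.1.2 _⟩, y.1.2))
      (P := fun b _ => Suspension.pole b)
      (Suspension.continuous_cyl.comp (hpush'.prodMk (by fun_prop)))
      (fun b => continuous_const) (fun _ _ => Suspension.cyl_zero _)
      (fun _ _ => Suspension.cyl_one _) (fun y => ?_) (fun _ => rfl) (fun _ => rfl) fun _ => rfl
    simp [D.push_zero]
  have h2 : m.Homotopic ((D.toSuspension n).comp (ofSuspension p q n)) := by
    refine Suspension.homotopic_of_cyl (G := fun y => Suspension.cyl (D.suspHomotopy n y))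
      (P := fun b _ => Suspension.pole b)
      (Suspension.continuous_cyl.comp (D.continuous_suspHomotopy n))
      (fun b => continuous_const) (D.suspHomotopy_south n) (D.suspHomotopy_north n)
      (fun y => ?_) (fun _ => rfl) (fun y => (D.suspHomotopy_one n y).symm) fun b => ?_
    · rw [D.suspHomotopy_zero]; rfl
    · cases b
      · change Suspension.ofCoords _ (D.balance (dirac p)) (D.height (dirac p)) = _
        rw [D.height_dirac_left, Suspension.ofCoords_zero]
      · change Suspension.ofCoords _ (D.balance (dirac q)) (D.height (dirac q)) = _
        rw [D.height_dirac_right, Suspension.ofCoords_one]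
  exact (h1.trans h2).symm

/-- The union of the two cones is the suspension of their intersection. -/
theorem union_coneBary_homotopyEquiv (D : NDRPair p q) (n : ℕ) :
    Nonempty ((coneBary p n ∪ coneBary q n : Set (Bary X)) ≃ₕ
      Suspension (mergedBary (merge p q) n)) :=
  nonempty_homotopyEquiv (D.toSuspension n) (ofSuspension p q n)
    (D.ofSuspension_comp_toSuspension_homotopic n) (D.toSuspension_comp_ofSuspension_homotopic n)

end NDRPair

/-! ### Counting weights -/

section Count

variable {X : Type u} [DecidableEq X] {p q : X} (S : Finset X)

theorem Finset.card_erase_left_eq (hpq : p ≠ q) :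
    (S.erase p).card = ((S.erase p).erase q).card + if q ∈ S then 1 else 0 := by
  split_ifs with h
  · exact (Finset.card_erase_add_one (Finset.mem_erase.2 ⟨hpq.symm, h⟩)).symm
  · rw [Finset.erase_eq_of_notMem (a := q) fun h' => h (Finset.mem_of_mem_erase h'), add_zero]

theorem Finset.card_erase_right_eq (hpq : p ≠ q) :
    (S.erase q).card = ((S.erase p).erase q).card + if p ∈ S then 1 else 0 := by
  rw [Finset.erase_right_comm]
  exact S.card_erase_left_eq hpq.symm

theorem Finset.card_eq_card_erase_erase (hpq : p ≠ q) :
    S.card = ((S.erase p).erase q).card + (if p ∈ S then 1 else 0) + if q ∈ S then 1 else 0 := by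
  rw [add_right_comm, ← S.card_erase_left_eq hpq]
  split_ifs with h
  · exact (Finset.card_erase_add_one h).symm
  · rw [Finset.erase_eq_of_notMem h, add_zero]

theorem Finset.card_image_merge (p q : X) :
    (S.image (merge p q)).card = ((S.erase p).erase q).card + if p ∈ S ∨ q ∈ S then 1 else 0 := by
  have hfix : ∀ x, x ≠ q → merge p q x = x := fun x hx =>
    (merge_cases p q x).resolve_right fun h => hx h.1
  split_ifs with h
  · rw [← Finset.card_insert_of_notMem (a := p) (by simp)]
    congr 1
    ext y
    simp only [Finset.mem_image, Finset.mem_insert, Finset.mem_erase]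
    constructor
    · rintro ⟨x, hx, rfl⟩
      rcases merge_cases p q x with hm | ⟨-, hm⟩
      · by_cases hxp : x = p
        · exact .inl (by rw [hxp, merge_left])
        · by_cases hxq : x = q
          · exact .inl (by rw [hxq, merge_right])
          · exact .inr (by rw [hm]; exact ⟨hxq, hxp, hx⟩)
      · exact .inl hm
    · rintro (rfl | ⟨hq, -, hy⟩)
      · rcases h with h | h
        exacts [⟨_, h, merge_left _ _⟩, ⟨_, h, merge_right _ _⟩]
      · exact ⟨y, hy, hfix y hq⟩
  · push Not at h
    rw [Finset.erase_eq_of_notMem h.1, Finset.erase_eq_of_notMem h.2, add_zero]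
    refine Finset.card_image_of_injOn fun x hx y hy hxy => ?_
    rwa [hfix x fun h' => h.2 (h' ▸ hx), hfix y fun h' => h.2 (h' ▸ hy)] at hxy

theorem sum_singularWeight (hpq : p ≠ q) (w₁ w₂ : ℝ) :
    ∑ x ∈ S, singularWeight ![p, q] ![w₁, w₂] x = ((S.erase p).erase q).card +
      ((if p ∈ S then w₁ else 0) + if q ∈ S then w₂ else 0) := by
  have hinj : Function.Injective ![p, q] := by
    intro i j h
    fin_cases i <;> fin_cases j <;> simp_all [hpq.symm]
  have hp : singularWeight ![p, q] ![w₁, w₂] p = w₁ := hinj.extend_apply ![w₁, w₂] _ 0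
  have hq : singularWeight ![p, q] ![w₁, w₂] q = w₂ := hinj.extend_apply ![w₁, w₂] _ 1
  have hx : ∀ x, x ≠ p → x ≠ q → singularWeight ![p, q] ![w₁, w₂] x = 1 := by
    intro x h1 h2
    refine Function.extend_apply' _ _ _ ?_
    rintro ⟨i, hi⟩
    fin_cases i
    exacts [h1 hi.symm, h2 hi.symm]
  have hE : ∑ x ∈ (S.erase p).erase q, singularWeight ![p, q] ![w₁, w₂] x =
      ((S.erase p).erase q).card := by
    rw [Finset.sum_congr rfl (g := fun _ => (1 : ℝ)) fun x h => ?_]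
    · simp
    · simp only [Finset.mem_erase] at h
      exact hx x h.2.1 h.1
  have h1 : ∑ x ∈ S, singularWeight ![p, q] ![w₁, w₂] x =
      ∑ x ∈ S.erase p, singularWeight ![p, q] ![w₁, w₂] x + if p ∈ S then w₁ else 0 := by
    split_ifs with h
    · rw [← Finset.sum_erase_add _ _ h, hp]
    · rw [Finset.erase_eq_of_notMem h, add_zero]
  have h2 : ∑ x ∈ S.erase p, singularWeight ![p, q] ![w₁, w₂] x =
      ∑ x ∈ (S.erase p).erase q, singularWeight ![p, q] ![w₁, w₂] x + if q ∈ S then w₂ else 0 := by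
    split_ifs with h
    · rw [← Finset.sum_erase_add _ _ (Finset.mem_erase.2 ⟨hpq.symm, h⟩), hq]
    · rw [Finset.erase_eq_of_notMem (a := q) fun h' => h (Finset.mem_of_mem_erase h'), add_zero]
  rw [h1, h2, hE]
  ring

end Count

/-- If `j` is the least integer with `n + a ≤ ρ + j`, then `n - j` is the largest number of points
of weight `1` that may accompany points of total weight `a`. -/
theorem natCast_add_le_iff {ρ a : ℝ} {n k j : ℕ} (h1 : n + a ≤ ρ + j) (h2 : ρ + j < n + 1 + a) :
    (k : ℝ) + a ≤ ρ ↔ k + j ≤ n := by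
  constructor
  · intro h
    by_contra! hc
    have : (n : ℝ) + 1 ≤ k + j := by exact_mod_cast hc
    linarith
  · intro h
    have : (k : ℝ) + j ≤ n := by exact_mod_cast h
    linarith

/-! ### The weighted spaces in the five regimes -/

section Regimes

variable {X : Type u} {p q : X} {ρ w₁ w₂ : ℝ}

open scoped Classical in
/-- Membership in the weighted space, if `j₁`, `j₂`, `j₁₂` are the numbers of points of weight `1`
that have to be given up in order to allow the points `p`, `q`, or both of them. -/
theorem mem_weightedBary_iff (hpq : p ≠ q) (hρ : 0 < ρ) {j₁ j₂ j₁₂ : ℕ}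
    (h1 : ⌊ρ⌋₊ + w₁ ≤ ρ + j₁) (h1' : ρ + j₁ < ⌊ρ⌋₊ + 1 + w₁)
    (h2 : ⌊ρ⌋₊ + w₂ ≤ ρ + j₂) (h2' : ρ + j₂ < ⌊ρ⌋₊ + 1 + w₂)
    (h3 : ⌊ρ⌋₊ + (w₁ + w₂) ≤ ρ + j₁₂) (h3' : ρ + j₁₂ < ⌊ρ⌋₊ + 1 + (w₁ + w₂)) (μ : Bary X) :
    μ ∈ weightedBary ![p, q] ![w₁, w₂] ρ ↔ ((μ.support.erase p).erase q).card +
      (if p ∈ μ.support then if q ∈ μ.support then j₁₂ else j₁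
        else if q ∈ μ.support then j₂ else 0) ≤ ⌊ρ⌋₊ := by
  have hn := Nat.floor_le hρ.le
  have hn' := Nat.lt_floor_add_one ρ
  change ∑ x ∈ μ.support, singularWeight ![p, q] ![w₁, w₂] x ≤ ρ ↔ _
  rw [sum_singularWeight _ hpq]
  split_ifs
  · exact natCast_add_le_iff h3 h3'
  · rw [add_zero]
    exact natCast_add_le_iff h1 h1'
  · rw [zero_add]
    exact natCast_add_le_iff h2 h2'
  · rw [add_zero]
    exact natCast_add_le_iff (by simpa using hn) (by simpa using hn')

theorem mem_conicalBary_iff [DecidableEq X] (p q : X) (n : ℕ) (μ : Bary X) :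
    μ ∈ conicalBary n ![{p}, {q}] ↔ ((μ.support.erase p).erase q).card ≤ n := by
  have hA : ∀ y, y ∈ ⋃ i, (![{p}, {q}] : Fin 2 → Set X) i ↔ y = p ∨ y = q := by
    intro y
    simp [Set.mem_iUnion, Fin.exists_fin_two]
  constructor
  · rintro ⟨t, x, a, ha, rfl⟩
    refine (Finset.card_le_card (t := Finset.univ.image x) fun y hy => ?_).trans
      (Finset.card_image_le.trans (by simp))
    simp only [Finset.mem_erase] at hy
    obtain ⟨i, hi⟩ := support_formalSum_subset _ hy.2.2
    refine Fin.addCases (fun i hi => ?_) (fun j hj => ?_) i hi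
    · exact Finset.mem_image.2 ⟨i, Finset.mem_univ _, by simpa using hi⟩
    · have hj : a j = y := by simpa using hj
      rcases (hA _).1 (ha j) with h | h
      · exact absurd (hj.symm.trans h) hy.2.1
      · exact absurd (hj.symm.trans h) hy.1
  · intro h
    have : Nonempty X := ⟨p⟩
    let e : Fin ((μ.support.erase p).erase q).card ≃ ((μ.support.erase p).erase q) :=
      Finset.equivFin _ |>.symm
    let x : Fin n → X := fun i =>
      if hi : i.1 < ((μ.support.erase p).erase q).card then e ⟨i, hi⟩ else p
    obtain ⟨t, ht⟩ := exists_formalSum_eq μ (Fin.append x ![p, q]) (by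
      intro y hy
      by_cases hp : y = p
      · exact ⟨Fin.natAdd n 0, by simp [hp]⟩
      by_cases hq : y = q
      · exact ⟨Fin.natAdd n 1, by simp [hq]⟩
      have hy' : y ∈ (μ.support.erase p).erase q :=
        Finset.mem_erase.2 ⟨hq, Finset.mem_erase.2 ⟨hp, hy⟩⟩
      refine ⟨Fin.castAdd 2 ⟨e.symm ⟨y, hy'⟩, (e.symm ⟨y, hy'⟩).2.trans_le h⟩, ?_⟩
      rw [Fin.append_left]
      simp [x])
    refine ⟨t, x, ![p, q], fun j => (hA _).2 ?_, ht.symm⟩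
    fin_cases j
    exacts [.inl rfl, .inr rfl]

theorem weightedBary_eq_conicalBary (hpq : p ≠ q) (hρ : 0 < ρ) (hw₁ : 0 < w₁) (hw₂ : 0 < w₂)
    (h : ⌊ρ⌋₊ + w₁ + w₂ ≤ ρ) :
    weightedBary ![p, q] ![w₁, w₂] ρ = conicalBary ⌊ρ⌋₊ ![{p}, {q}] := by
  classical
  have hn' := Nat.lt_floor_add_one ρ
  ext μ
  rw [mem_weightedBary_iff hpq hρ (j₁ := 0) (j₂ := 0) (j₁₂ := 0) (by push_cast; linarith)
    (by push_cast; linarith) (by push_cast; linarith) (by push_cast; linarith)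
    (by push_cast; linarith) (by push_cast; linarith), mem_conicalBary_iff]
  simp

theorem weightedBary_eq_union_coneBary (hpq : p ≠ q) (hρ : 0 < ρ) (hw₁ : 0 < w₁) (hw₂ : 0 < w₂)
    (h1 : ⌊ρ⌋₊ + w₁ ≤ ρ) (h2 : ⌊ρ⌋₊ + w₂ ≤ ρ)
    (h : ρ < ⌊ρ⌋₊ + w₁ + w₂) :
    weightedBary ![p, q] ![w₁, w₂] ρ = coneBary p ⌊ρ⌋₊ ∪ coneBary q ⌊ρ⌋₊ := by
  classical
  have hn' := Nat.lt_floor_add_one ρ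
  ext μ
  rw [mem_weightedBary_iff hpq hρ (j₁ := 0) (j₂ := 0) (j₁₂ := 1) (by push_cast; linarith)
    (by push_cast; linarith) (by push_cast; linarith) (by push_cast; linarith)
    (by push_cast; linarith) (by push_cast; linarith)]
  change _ ↔ (μ.support.erase p).card ≤ _ ∨ (μ.support.erase q).card ≤ _
  have hp := μ.support.card_erase_left_eq hpq
  have hq := μ.support.card_erase_right_eq hpq
  split_ifs at hp hq ⊢ <;> omega

theorem weightedBary_eq_coneBary (hpq : p ≠ q) (hρ : 0 < ρ) (hw₁ : 0 < w₁)
    (h1 : ⌊ρ⌋₊ + w₁ ≤ ρ) (h2 : ρ < ⌊ρ⌋₊ + w₂)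
    (h : ⌊ρ⌋₊ + w₁ + w₂ ≤ 1 + ρ) :
    weightedBary ![p, q] ![w₁, w₂] ρ = coneBary p ⌊ρ⌋₊ := by
  classical
  have hn' := Nat.lt_floor_add_one ρ
  ext μ
  rw [mem_weightedBary_iff hpq hρ (j₁ := 0) (j₂ := 1) (j₁₂ := 1) (by push_cast; linarith)
    (by push_cast; linarith) (by push_cast; linarith) (by push_cast; linarith)
    (by push_cast; linarith) (by push_cast; linarith)]
  change _ ↔ (μ.support.erase p).card ≤ _
  rw [Finset.card_erase_left_eq _ hpq]
  split_ifs <;> omega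

theorem weightedBary_eq_mergedBary (hpq : p ≠ q) (hρ : 0 < ρ) (hw₁ : 0 < w₁) (hw₂ : 0 < w₂)
    (h1 : ρ < ⌊ρ⌋₊ + w₁) (h2 : ρ < ⌊ρ⌋₊ + w₂)
    (h : ⌊ρ⌋₊ + w₁ + w₂ ≤ 1 + ρ) :
    weightedBary ![p, q] ![w₁, w₂] ρ = mergedBary (merge p q) ⌊ρ⌋₊ := by
  classical
  have hn' := Nat.lt_floor_add_one ρ
  ext μ
  rw [mem_weightedBary_iff hpq hρ (j₁ := 1) (j₂ := 1) (j₁₂ := 1) (by push_cast; linarith)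
    (by push_cast; linarith) (by push_cast; linarith) (by push_cast; linarith)
    (by push_cast; linarith) (by push_cast; linarith)]
  change _ ↔ (μ.support.image (merge p q)).card ≤ _
  rw [Finset.card_image_merge]
  split_ifs <;> grind

theorem weightedBary_eq_baryFiltration (hpq : p ≠ q) (hρ : 0 < ρ)
    (h1 : ρ < ⌊ρ⌋₊ + w₁) (h1' : ⌊ρ⌋₊ + w₁ ≤ 1 + ρ)
    (h2 : ρ < ⌊ρ⌋₊ + w₂) (h2' : ⌊ρ⌋₊ + w₂ ≤ 1 + ρ) (h : 1 + ρ < ⌊ρ⌋₊ + w₁ + w₂)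
    (h' : ⌊ρ⌋₊ + w₁ + w₂ ≤ 2 + ρ) :
    weightedBary ![p, q] ![w₁, w₂] ρ = baryFiltration X ⌊ρ⌋₊ := by
  classical
  ext μ
  rw [mem_weightedBary_iff hpq hρ (j₁ := 1) (j₂ := 1) (j₁₂ := 2) (by push_cast; linarith)
    (by push_cast; linarith) (by push_cast; linarith) (by push_cast; linarith)
    (by push_cast; linarith) (by push_cast; linarith)]
  change _ ↔ μ.support.card ≤ _
  have hc := μ.support.card_eq_card_erase_erase hpq
  split_ifs at hc ⊢ <;> omega

variable [TopologicalSpace X]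

theorem contractibleSpace_coneBary (p : X) (n : ℕ) : ContractibleSpace (coneBary p n) := by
  classical
  refine contractibleSpace_of_starShaped p (dirac_mem_coneBary p n) fun μ hμ t =>
    mem_coneBary_of_subset hμ fun x hx => ?_
  simpa [or_comm] using support_mix_subset t μ (dirac p) hx

theorem contractibleSpace_conicalBary (p q : X) (n : ℕ) :
    ContractibleSpace (conicalBary n ![{p}, {q}]) := by
  classical
  refine contractibleSpace_of_starShaped p ((mem_conicalBary_iff _ _ _ _).2 (by simp))
    fun μ hμ t => ?_
  rw [mem_conicalBary_iff] at hμ ⊢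
  refine (Finset.card_le_card fun x hx => ?_).trans hμ
  have h := @support_mix_subset _ _ t μ (dirac p) x
  simp only [Finset.mem_union, support_dirac, Finset.mem_singleton, Finset.mem_erase] at h hx ⊢
  exact ⟨hx.1, hx.2.1, (h hx.2.2).resolve_right hx.2.1⟩

theorem weightedBary_homotopyEquiv_suspension [T1Space X] (D : NDRPair p q) {E : Type v}
    [TopologicalSpace E] (hρ : 0 < ρ) (hw₁ : 0 < w₁) (hw₂ : 0 < w₂) (e : Arc p q ≃ₕ E)
    (h1 : ⌊ρ⌋₊ + w₁ ≤ ρ) (h2 : ⌊ρ⌋₊ + w₂ ≤ ρ)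
    (h : ρ < ⌊ρ⌋₊ + w₁ + w₂) :
    Nonempty (weightedBary ![p, q] ![w₁, w₂] ρ ≃ₕ Suspension (baryFiltration E ⌊ρ⌋₊)) := by
  rw [weightedBary_eq_union_coneBary D.ne hρ hw₁ hw₂ h1 h2 h]
  obtain ⟨e₁⟩ := D.union_coneBary_homotopyEquiv ⌊ρ⌋₊
  obtain ⟨e₂⟩ := D.mergedBary_homotopyEquiv ⌊ρ⌋₊
  obtain ⟨e₃⟩ := baryFiltration_homotopyEquiv e ⌊ρ⌋₊
  obtain ⟨e₄⟩ := Suspension.nonempty_homotopyEquiv (e₂.trans e₃)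
  exact ⟨e₁.trans e₄⟩

theorem weightedBary_homotopyEquiv_baryFiltration [T1Space X] (D : NDRPair p q) {E : Type v}
    [TopologicalSpace E] (hρ : 0 < ρ) (hw₁ : 0 < w₁) (hw₂ : 0 < w₂) (e : Arc p q ≃ₕ E)
    (h1 : ρ < ⌊ρ⌋₊ + w₁) (h2 : ρ < ⌊ρ⌋₊ + w₂)
    (h : ⌊ρ⌋₊ + w₁ + w₂ ≤ 1 + ρ) :
    Nonempty (weightedBary ![p, q] ![w₁, w₂] ρ ≃ₕ baryFiltration E ⌊ρ⌋₊) := by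
  rw [weightedBary_eq_mergedBary D.ne hρ hw₁ hw₂ h1 h2 h]
  obtain ⟨e₂⟩ := D.mergedBary_homotopyEquiv ⌊ρ⌋₊
  obtain ⟨e₃⟩ := baryFiltration_homotopyEquiv e ⌊ρ⌋₊
  exact ⟨e₂.trans e₃⟩

end Regimes

/-- An arc between points of the two summands gives the wedge, at any nondegenerate points. -/
theorem Arc.homotopyEquiv_wedge_of_pathConnected {A : Type u} {B : Type v} [TopologicalSpace A]
    [TopologicalSpace B] [T2Space A] [T2Space B] [PathConnectedSpace A] [PathConnectedSpace B]
    (p a : A) (q b : B) (ha : IsNondegeneratePt a) (hb : IsNondegeneratePt b) :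
    Nonempty (Arc (Sum.inl p : A ⊕ B) (Sum.inr q) ≃ₕ Wedge a b) := by
  obtain ⟨D⟩ := (ha.inl (B := B)).nonempty_ndrPair (hb.inr (A := A)) Sum.inl_ne_inr
  obtain ⟨e₁⟩ := Arc.homotopyEquiv_of_joined
    (((PathConnectedSpace.joined p a).map continuous_inl : Joined (Sum.inl p : A ⊕ B) (Sum.inl a)))
    (((PathConnectedSpace.joined q b).map continuous_inr : Joined (Sum.inr q : A ⊕ B) (Sum.inr b)))
  obtain ⟨e₂⟩ := Arc.homotopyEquiv_wedge D
  exact ⟨e₁.trans e₂⟩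

/-- An arc between points of the first summand is, up to homotopy, a circle wedged to it. -/
theorem Arc.homotopyEquiv_wedge_circle_of_pathConnected {A : Type u} {B : Type v}
    [TopologicalSpace A] [TopologicalSpace B] [PathConnectedSpace A] (p q a : A) :
    Nonempty (Arc (Sum.inl p : A ⊕ B) (Sum.inl q) ≃ₕ (Wedge a (1 : Circle) ⊕ B)) := by
  obtain ⟨e₁⟩ := Arc.homotopyEquiv_of_joined
    (((PathConnectedSpace.joined p a).map continuous_inl : Joined (Sum.inl p : A ⊕ B) (Sum.inl a)))
    (((PathConnectedSpace.joined q a).map continuous_inl : Joined (Sum.inl q : A ⊕ B) (Sum.inl a)))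
  obtain ⟨e₂⟩ := Arc.homotopyEquiv_wedge_circle (B := B) a
  exact ⟨e₁.trans e₂⟩

theorem proposition6p2 {A₁ : Type u} {A₂ : Type v} [TopologicalSpace A₁] [TopologicalSpace A₂]
    [T2Space A₁] [T2Space A₂] [ConnectedSpace A₁] [ConnectedSpace A₂]
    (ρ w₁ w₂ : ℝ) (hρ : 0 < ρ) (hw₁ : 0 < w₁) (hw₂ : 0 < w₂) :
    -- regime 1
    (⌊ρ⌋₊ + w₁ + w₂ ≤ ρ →
      (∀ (p₁ : A₁) (p₂ : A₂),
        Nonempty (weightedBary (X := A₁ ⊕ A₂) ![.inl p₁, .inr p₂] ![w₁, w₂] ρ ≃ₕ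
          conicalBary (X := A₁ ⊕ A₂) ⌊ρ⌋₊ ![{.inl p₁}, {.inr p₂}]) ∧
        ContractibleSpace (conicalBary (X := A₁ ⊕ A₂) ⌊ρ⌋₊ ![{.inl p₁}, {.inr p₂}]) ∧
        ContractibleSpace (weightedBary (X := A₁ ⊕ A₂) ![.inl p₁, .inr p₂] ![w₁, w₂] ρ)) ∧
      (∀ p₁ p₂ : A₁, p₁ ≠ p₂ →
        Nonempty (weightedBary (X := A₁ ⊕ A₂) ![.inl p₁, .inl p₂] ![w₁, w₂] ρ ≃ₕ
          conicalBary (X := A₁ ⊕ A₂) ⌊ρ⌋₊ ![{.inl p₁}, {.inl p₂}]) ∧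
        ContractibleSpace (conicalBary (X := A₁ ⊕ A₂) ⌊ρ⌋₊ ![{.inl p₁}, {.inl p₂}]) ∧
        ContractibleSpace (weightedBary (X := A₁ ⊕ A₂) ![.inl p₁, .inl p₂] ![w₁, w₂] ρ))) ∧
    -- regime 2
    (⌊ρ⌋₊ + w₁ ≤ ρ → ⌊ρ⌋₊ + w₂ ≤ ρ → ρ < ⌊ρ⌋₊ + w₁ + w₂ →
      (∀ (p₁ : A₁) (p₂ : A₂) (a₁ : A₁) (a₂ : A₂), PathConnectedSpace A₁ → PathConnectedSpace A₂ →
        IsNondegeneratePt p₁ → IsNondegeneratePt p₂ →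
        IsNondegeneratePt a₁ → IsNondegeneratePt a₂ →
        Nonempty (weightedBary (X := A₁ ⊕ A₂) ![.inl p₁, .inr p₂] ![w₁, w₂] ρ ≃ₕ
          Suspension (baryFiltration (Wedge a₁ a₂) ⌊ρ⌋₊))) ∧
      (∀ p₁ p₂ a : A₁, p₁ ≠ p₂ → PathConnectedSpace A₁ →
        IsNondegeneratePt p₁ → IsNondegeneratePt p₂ →
        Nonempty (weightedBary (X := A₁ ⊕ A₂) ![.inl p₁, .inl p₂] ![w₁, w₂] ρ ≃ₕ
          Suspension (baryFiltration (Wedge a (1 : Circle) ⊕ A₂) ⌊ρ⌋₊)))) ∧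
    -- regime 3
    (⌊ρ⌋₊ + w₁ ≤ ρ → ρ < ⌊ρ⌋₊ + w₂ → ⌊ρ⌋₊ + w₁ + w₂ ≤ 1 + ρ →
      (∀ (p₁ : A₁) (p₂ : A₂),
        ContractibleSpace (weightedBary (X := A₁ ⊕ A₂) ![.inl p₁, .inr p₂] ![w₁, w₂] ρ)) ∧
      (∀ p₁ p₂ : A₁, p₁ ≠ p₂ →
        ContractibleSpace (weightedBary (X := A₁ ⊕ A₂) ![.inl p₁, .inl p₂] ![w₁, w₂] ρ))) ∧
    -- regime 4
    (ρ < ⌊ρ⌋₊ + w₁ → ρ < ⌊ρ⌋₊ + w₂ → ⌊ρ⌋₊ + w₁ + w₂ ≤ 1 + ρ →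
      (∀ (p₁ : A₁) (p₂ : A₂) (a₁ : A₁) (a₂ : A₂), PathConnectedSpace A₁ → PathConnectedSpace A₂ →
        IsNondegeneratePt p₁ → IsNondegeneratePt p₂ →
        IsNondegeneratePt a₁ → IsNondegeneratePt a₂ →
        Nonempty (weightedBary (X := A₁ ⊕ A₂) ![.inl p₁, .inr p₂] ![w₁, w₂] ρ ≃ₕ
          baryFiltration (Wedge a₁ a₂) ⌊ρ⌋₊)) ∧
      (∀ p₁ p₂ a : A₁, p₁ ≠ p₂ → PathConnectedSpace A₁ →
        IsNondegeneratePt p₁ → IsNondegeneratePt p₂ →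
        Nonempty (weightedBary (X := A₁ ⊕ A₂) ![.inl p₁, .inl p₂] ![w₁, w₂] ρ ≃ₕ
          baryFiltration (Wedge a (1 : Circle) ⊕ A₂) ⌊ρ⌋₊))) ∧
    -- regime 5
    (ρ < ⌊ρ⌋₊ + w₁ → ⌊ρ⌋₊ + w₁ ≤ 1 + ρ → ρ < ⌊ρ⌋₊ + w₂ → ⌊ρ⌋₊ + w₂ ≤ 1 + ρ →
      1 + ρ < ⌊ρ⌋₊ + w₁ + w₂ → ⌊ρ⌋₊ + w₁ + w₂ ≤ 2 + ρ →
      (∀ (p₁ : A₁) (p₂ : A₂),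
        weightedBary (X := A₁ ⊕ A₂) ![.inl p₁, .inr p₂] ![w₁, w₂] ρ =
          baryFiltration (A₁ ⊕ A₂) ⌊ρ⌋₊) ∧
      (∀ p₁ p₂ : A₁, p₁ ≠ p₂ →
        weightedBary (X := A₁ ⊕ A₂) ![.inl p₁, .inl p₂] ![w₁, w₂] ρ =
          baryFiltration (A₁ ⊕ A₂) ⌊ρ⌋₊)) := by
  have inl_inr : ∀ (p₁ : A₁) (p₂ : A₂), (Sum.inl p₁ : A₁ ⊕ A₂) ≠ Sum.inr p₂ :=
    fun _ _ => Sum.inl_ne_inr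
  have inl_inl : ∀ p₁ p₂ : A₁, p₁ ≠ p₂ → (Sum.inl p₁ : A₁ ⊕ A₂) ≠ Sum.inl p₂ :=
    fun _ _ h => Sum.inl_injective.ne h
  refine ⟨fun h => ?_, fun h1 h2 h => ?_, fun h1 h2 h => ?_, fun h1 h2 h => ?_,
    fun h1 h1' h2 h2' h h' => ?_⟩
  · refine ⟨fun p₁ p₂ => ?_, fun p₁ p₂ hp => ?_⟩
    · rw [weightedBary_eq_conicalBary (inl_inr p₁ p₂) hρ hw₁ hw₂ h]
      exact ⟨⟨.refl _⟩, contractibleSpace_conicalBary _ _ _, contractibleSpace_conicalBary _ _ _⟩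
    · rw [weightedBary_eq_conicalBary (inl_inl p₁ p₂ hp) hρ hw₁ hw₂ h]
      exact ⟨⟨.refl _⟩, contractibleSpace_conicalBary _ _ _, contractibleSpace_conicalBary _ _ _⟩
  · refine ⟨fun p₁ p₂ a₁ a₂ _ _ n₁ n₂ n₃ n₄ => ?_, fun p₁ p₂ a hp _ n₁ n₂ => ?_⟩
    · obtain ⟨D⟩ := (n₁.inl (B := A₂)).nonempty_ndrPair (n₂.inr (A := A₁)) (inl_inr p₁ p₂)
      obtain ⟨e⟩ := Arc.homotopyEquiv_wedge_of_pathConnected p₁ a₁ p₂ a₂ n₃ n₄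
      exact weightedBary_homotopyEquiv_suspension D hρ hw₁ hw₂ e h1 h2 h
    · obtain ⟨D⟩ := (n₁.inl (B := A₂)).nonempty_ndrPair (n₂.inl (B := A₂)) (inl_inl p₁ p₂ hp)
      obtain ⟨e⟩ := Arc.homotopyEquiv_wedge_circle_of_pathConnected (B := A₂) p₁ p₂ a
      exact weightedBary_homotopyEquiv_suspension D hρ hw₁ hw₂ e h1 h2 h
  · refine ⟨fun p₁ p₂ => ?_, fun p₁ p₂ hp => ?_⟩
    · rw [weightedBary_eq_coneBary (inl_inr p₁ p₂) hρ hw₁ h1 h2 h]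
      exact contractibleSpace_coneBary _ _
    · rw [weightedBary_eq_coneBary (inl_inl p₁ p₂ hp) hρ hw₁ h1 h2 h]
      exact contractibleSpace_coneBary _ _
  · refine ⟨fun p₁ p₂ a₁ a₂ _ _ n₁ n₂ n₃ n₄ => ?_, fun p₁ p₂ a hp _ n₁ n₂ => ?_⟩
    · obtain ⟨D⟩ := (n₁.inl (B := A₂)).nonempty_ndrPair (n₂.inr (A := A₁)) (inl_inr p₁ p₂)
      obtain ⟨e⟩ := Arc.homotopyEquiv_wedge_of_pathConnected p₁ a₁ p₂ a₂ n₃ n₄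
      exact weightedBary_homotopyEquiv_baryFiltration D hρ hw₁ hw₂ e h1 h2 h
    · obtain ⟨D⟩ := (n₁.inl (B := A₂)).nonempty_ndrPair (n₂.inl (B := A₂)) (inl_inl p₁ p₂ hp)
      obtain ⟨e⟩ := Arc.homotopyEquiv_wedge_circle_of_pathConnected (B := A₂) p₁ p₂ a
      exact weightedBary_homotopyEquiv_baryFiltration D hρ hw₁ hw₂ e h1 h2 h
  · exact ⟨fun p₁ p₂ => weightedBary_eq_baryFiltration (inl_inr p₁ p₂) hρ h1 h1' h2 h2' h h',
      fun p₁ p₂ hp => weightedBary_eq_baryFiltration (inl_inl p₁ p₂ hp) hρ h1 h1' h2 h2' h h'⟩
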